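/- Let $A[1..n]$, $n\ge 1$, be an array of keys from a linearly ordered set. Scanning from left to right, cut $A$ into runs: each run is the longest region starting at the current position that is either weakly increasing or strictly decreasing, and the next run starts right after it. Let $L_1,\ldots,L_r$ (with $L_1+\cdots+L_r=n$) be the run lengths, and let $\mathcal H=\mathcal H(\frac{L_1}n,\ldots,\frac{L_r}n)$, where $\mathcal H(p_1,\ldots,p_r)=\sum_i p_i\lg(1/p_i)$ and $\lg=\log_2$. PowerSort is the following mergesort. It finds the runs one after the other from left to right by comparing neighbouring keys, and immediately reverses decreasing runs in place. It keeps a stack $X$ of runs and a stack $P$ of numbers, both initially empty. Let $A[s_1..e_1]$ be the first run. While $e_1<n$: find the next run $A[s_2..e_2]$, $s_2=e_1+1$; let $p$ be the least $\ell\in\mathbb N$ with $\lfloor a2^\ell\rfloor\ne\lfloor b2^\ell\rfloor$, where $a=(s_1+\frac{n_1}2-1)/n$, $b=(s_2+\frac{n_2}2-1)/n$, $n_i=e_i-s_i+1$; while the top of $P$ exists and is greater than $p$, pop $P$, pop a run from $X$, merge it with $A[s_1..e_1]$, and let $A[s_1..e_1]$ be the result; then push $A[s_1..e_1]$ on $X$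 and $p$ on $P$, and set $(s_1,e_1)\gets(s_2,e_2)$. Finally, while $X$ is not empty, pop a run from $X$, merge it with $A[s_1..e_1]$, and let $A[s_1..e_1]$ be the result. Merging is the standard two-way merge, which stops comparing as soon as one of the two runs is exhausted; merging runs of lengths $m$ and $m'$ has merge cost $m+m'$, and the merge cost of PowerSort is the sum over all its merges. Then PowerSort terminates, its merge cost is at most $\mathcal H\cdot n+2n$, and it makes at most $\mathcal H\cdot n+3n-r$ key comparisons (including those made to find the runs). The heights of its stacks never exceed $\lfloor\lg n\rfloor+1$, and apart from the array and the buffer for merging it uses only $O(\log n)$ words of space, each of $O(\log n)$ bits, with absolute constants for $n \ge 2$. -/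

import Mathlib

namespace PowerSort

/-! ## Entropy and runs of an array

An array `A[1..n]` is a function `A : ℕ → α` of which only the cells `1, …, n` matter. -/

/-- The binary Shannon entropy `∑ pᵢ lg (1 / pᵢ)` of a list of probabilities. -/
noncomputable def entropy (p : List ℝ) : ℝ :=
  (p.map fun x => x * Real.logb 2 (1 / x)).sum

section Runs

variable {α : Type*} [LinearOrder α]

/-- `A[s..e]` is weakly increasing or strictly decreasing. -/
def IsRun (A : ℕ → α) (s e : ℕ) : Prop :=
  (∀ i ∈ Finset.Ico s e, A i ≤ A (i + 1)) ∨ (∀ i ∈ Finset.Ico s e, A (i + 1) < A i)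

instance (A : ℕ → α) (s : ℕ) : DecidablePred (IsRun A s) := fun e => by
  unfold IsRun; infer_instance

/-- The last position of the maximal run of `A[1..n]` that starts at position `s`. -/
def runEnd (A : ℕ → α) (n s : ℕ) : ℕ :=
  Nat.findGreatest (IsRun A s) n

theorem le_runEnd (A : ℕ → α) {n s : ℕ} (h : s ≤ n) : s ≤ runEnd A n s :=
  Nat.le_findGreatest h (Or.inl (by simp))

/-- The lengths, from left to right, of the runs into which a scan of `A[s..n]` from left to right
cuts it: each run is as long as possible, and the next one starts right after it. -/
def runLengthsFrom (A : ℕ → α) (n s : ℕ) : List ℕ :=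
  if h : s ≤ n then
    (runEnd A n s - s + 1) :: runLengthsFrom A n (runEnd A n s + 1)
  else []
termination_by n + 1 - s
decreasing_by
  have := le_runEnd A h
  omega

/-- The lengths `L₁, …, L_r` of the runs of `A[1..n]`. -/
def runLengths (A : ℕ → α) (n : ℕ) : List ℕ :=
  runLengthsFrom A n 1

end Runs

/-! ## A small imperative language

A program works on a fixed finite set of registers, each holding one machine word (a natural
number), on two stacks (`X`, whose entries are pairs of words, and `P`, whose entries are words), on
the array of keys that is to be sorted, and on a buffer of keys for merging. Keys can only be moved
and compared. There is no recursion. -/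

/-- The registers. -/
inductive Reg
  | n | s1 | e1 | s2 | e2 | p | a | b | l | m | i | j | k | c | d
  deriving DecidableEq

/-- The list of all registers. -/
def Reg.all : List Reg :=
  [.n, .s1, .e1, .s2, .e2, .p, .a, .b, .l, .m, .i, .j, .k, .c, .d]

theorem Reg.mem_all (x : Reg) : x ∈ Reg.all := by
  cases x <;> simp [Reg.all]

/-- Word expressions. Subtraction is truncated and division rounds down. -/
inductive Expr
  | const (v : ℕ)
  | reg (x : Reg)
  | add (u v : Expr)
  | sub (u v : Expr)
  | div (u v : Expr)

/-- Tests on words and stacks; none of them looks at a key. -/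
inductive Test
  | lt (u v : Expr)
  | le (u v : Expr)
  | eq (u v : Expr)
  | and (s t : Test)
  /-- the stack `X` is not empty -/
  | nonemptyX
  /-- the stack `P` is not empty and its top entry is greater than the register `x` -/
  | topPGt (x : Reg)

/-- A cell that holds a key, in the array or in the merge buffer. -/
inductive Cell
  | arr (u : Expr)
  | buf (u : Expr)

/-- Programs. -/
inductive Stmt
  | assign (x : Reg) (u : Expr)
  | seq (s t : Stmt)
  | ite (c : Test) (s t : Stmt)
  | skip
  | while (c : Test) (s : Stmt)
  /-- one key comparison: `x` becomes `1` if the key in `u` is less than the one in `v`, else `0` -/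
  | compare (x : Reg) (u v : Cell)
  /-- copy the key in `v` to `u` -/
  | copy (u v : Cell)
  /-- exchange two keys of the array -/
  | swap (u v : Expr)
  | pushX (x y : Reg)
  | popX (x y : Reg)
  | pushP (x : Reg)
  | popP
  /-- bookkeeping only: record that the merge cost grows by the value of `u` -/
  | tally (u : Expr)

/-- The memory of a machine. The last two fields are not accessible to the program: the number of
key comparisons made so far, and the merge cost so far. -/
structure Mem (α : Type*) where
  reg : Reg → ℕ
  X : List (ℕ × ℕ)
  P : List ℕ
  arr : ℕ → α
  buf : ℕ → α
  comparisons : ℕ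
  mergeCost : ℕ

section Semantics

variable {α : Type*} [LinearOrder α]

def Expr.eval (r : Reg → ℕ) : Expr → ℕ
  | .const v => v
  | .reg x => r x
  | .add u v => u.eval r + v.eval r
  | .sub u v => u.eval r - v.eval r
  | .div u v => u.eval r / v.eval r

def Test.eval (σ : Mem α) : Test → Bool
  | .lt u v => decide (u.eval σ.reg < v.eval σ.reg)
  | .le u v => decide (u.eval σ.reg ≤ v.eval σ.reg)
  | .eq u v => decide (u.eval σ.reg = v.eval σ.reg)
  | .and s t => s.eval σ && t.eval σ
  | .nonemptyX => !σ.X.isEmpty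
  | .topPGt x => match σ.P with
    | [] => false
    | q :: _ => decide (σ.reg x < q)

/-- The key in a cell. -/
def Mem.read (σ : Mem α) : Cell → α
  | .arr u => σ.arr (u.eval σ.reg)
  | .buf u => σ.buf (u.eval σ.reg)

/-- Store a key in a cell. -/
def Mem.write (σ : Mem α) (w : α) : Cell → Mem α
  | .arr u => { σ with arr := Function.update σ.arr (u.eval σ.reg) w }
  | .buf u => { σ with buf := Function.update σ.buf (u.eval σ.reg) w }

/-- Store a word in a register. -/
def Mem.set (σ : Mem α) (x : Reg) (v : ℕ) : Mem α :=
  { σ with reg := Function.update σ.reg x v }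

/-- A configuration: the statements that remain to be executed (that is, the current position in
the program), and the memory. The machine has halted when the list is empty. -/
abbrev Config (α : Type*) := List Stmt × Mem α

/-- One step of the machine. -/
def step : Config α → Config α
  | ([], σ) => ([], σ)
  | (.assign x u :: k, σ) => (k, σ.set x (u.eval σ.reg))
  | (.seq s t :: k, σ) => (s :: t :: k, σ)
  | (.ite c s t :: k, σ) => (if c.eval σ then s :: k else t :: k, σ)
  | (.skip :: k, σ) => (k, σ)
  | (.while c s :: k, σ) => (if c.eval σ then s :: .while c s :: k else k, σ)
  | (.compare x u v :: k, σ) =>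
      (k, { σ.set x (if σ.read u < σ.read v then 1 else 0) with
            comparisons := σ.comparisons + 1 })
  | (.copy u v :: k, σ) => (k, σ.write (σ.read v) u)
  | (.swap u v :: k, σ) =>
      (k, { σ with arr := σ.arr ∘ Equiv.swap (u.eval σ.reg) (v.eval σ.reg) })
  | (.pushX x y :: k, σ) => (k, { σ with X := (σ.reg x, σ.reg y) :: σ.X })
  | (.popX x y :: k, σ) => match σ.X with
      | [] => (k, σ)
      | (v, w) :: X => (k, { (σ.set x v).set y w with X := X })
  | (.pushP x :: k, σ) => (k, { σ with P := σ.reg x :: σ.P })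
  | (.popP :: k, σ) => (k, { σ with P := σ.P.tail })
  | (.tally u :: k, σ) => (k, { σ with mergeCost := σ.mergeCost + u.eval σ.reg })

/-- The machine words stored in a memory, apart from the array and the merge buffer. -/
def Mem.words (σ : Mem α) : List ℕ :=
  Reg.all.map σ.reg ++ σ.X.flatMap (fun q => [q.1, q.2]) ++ σ.P

/-- The extra space in use, in words, apart from the merge buffer: the words in registers and on
the two stacks, and one word for the position in the (fixed) program. -/
def Mem.space (σ : Mem α) : ℕ :=
  σ.words.length + 1

end Semantics

/-! ## The algorithm -/

instance : Coe Reg Expr := ⟨Expr.reg⟩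

instance (v : ℕ) : OfNat Expr v := ⟨Expr.const v⟩

instance : Add Expr := ⟨Expr.add⟩

instance : Sub Expr := ⟨Expr.sub⟩

instance : Div Expr := ⟨Expr.div⟩

/-- Execute a list of statements one after the other. -/
def block : List Stmt → Stmt
  | [] => .skip
  | s :: t => .seq s (block t)

/-- Reverse `A[s..e]` in place. -/
def reverse (s e : Reg) : Stmt := block [
  .assign .i s,
  .assign .j e,
  .while (.lt (Reg.i : Expr) (Reg.j : Expr)) (block [
    .swap (Reg.i : Expr) (Reg.j : Expr),
    .assign .i ((Reg.i : Expr) + 1),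
    .assign .j ((Reg.j : Expr) - 1)])]

/-- Let `A[s..e]` be the maximal run that starts at `s`, found by comparing neighbours from left to
right, and reverse it if it is decreasing. -/
def extendRunRight (s e : Reg) : Stmt := block [
  .assign e s,
  .ite (.lt (s : Expr) (Reg.n : Expr))
    (block [
      .compare .d (.arr ((s : Expr) + 1)) (.arr s),
      .assign e ((s : Expr) + 1),
      .assign .c Reg.d,
      .while (.and (.lt (e : Expr) (Reg.n : Expr)) (.eq (Reg.c : Expr) (Reg.d : Expr))) (block [
        .compare .c (.arr ((e : Expr) + 1)) (.arr e),
        .ite (.eq (Reg.c : Expr) (Reg.d : Expr)) (.assign e ((e : Expr) + 1)) .skip]),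
      .ite (.eq (Reg.d : Expr) 1) (reverse s e) .skip])
    .skip]

/-- Let `p` be the power of the node between the adjacent runs `A[s1..e1]` and `A[s2..e2]`: the
least `ℓ` such that `⌊a * 2 ^ ℓ⌋ ≠ ⌊b * 2 ^ ℓ⌋`, where `a = (s1 + n1 / 2 - 1) / n` and
`b = (s2 + n2 / 2 - 1) / n` (exact divisions) are the relative midpoints of the two runs, of lengths
`n1` and `n2`. Registers `a` and `b` hold `2 * n * 2 ^ p` times these numbers. -/
def nodePower : Stmt := block [
  .assign .p 0,
  .assign .a ((Reg.s1 : Expr) + Reg.s1 + ((Reg.e1 : Expr) - Reg.s1 + 1) - 2),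
  .assign .b ((Reg.s2 : Expr) + Reg.s2 + ((Reg.e2 : Expr) - Reg.s2 + 1) - 2),
  .while (.eq ((Reg.a : Expr) / ((Reg.n : Expr) + Reg.n)) ((Reg.b : Expr) / ((Reg.n : Expr) + Reg.n)))
    (block [
      .assign .a ((Reg.a : Expr) + Reg.a),
      .assign .b ((Reg.b : Expr) + Reg.b),
      .assign .p ((Reg.p : Expr) + 1)])]

/-- Pop a run `A[l..m]` from `X`, merge it with the run `A[s1..e1]` to its right by the standard
two-way merge (`A[l..m]` is moved to the buffer first; equal keys keep their order; no comparison is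
made once one of the two runs is exhausted), and let `A[s1..e1]` be the result. The merge cost is the
sum of the lengths of the two runs. -/
def mergeTop : Stmt := block [
  .popX .l .m,
  .tally (((Reg.m : Expr) - Reg.l + 1) + ((Reg.e1 : Expr) - Reg.s1 + 1)),
  .assign .i Reg.l,
  .while (.le (Reg.i : Expr) (Reg.m : Expr)) (block [
    .copy (.buf Reg.i) (.arr Reg.i),
    .assign .i ((Reg.i : Expr) + 1)]),
  .assign .i Reg.l,
  .assign .j Reg.s1,
  .assign .k Reg.l,
  .while (.and (.le (Reg.i : Expr) (Reg.m : Expr)) (.le (Reg.j : Expr) (Reg.e1 : Expr))) (block [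
    .compare .c (.arr Reg.j) (.buf Reg.i),
    .ite (.eq (Reg.c : Expr) 1)
      (block [
        .copy (.arr Reg.k) (.arr Reg.j),
        .assign .j ((Reg.j : Expr) + 1)])
      (block [
        .copy (.arr Reg.k) (.buf Reg.i),
        .assign .i ((Reg.i : Expr) + 1)]),
    .assign .k ((Reg.k : Expr) + 1)]),
  .while (.le (Reg.i : Expr) (Reg.m : Expr)) (block [
    .copy (.arr Reg.k) (.buf Reg.i),
    .assign .i ((Reg.i : Expr) + 1),
    .assign .k ((Reg.k : Expr) + 1)]),
  .assign .s1 Reg.l]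

/-- PowerSort. -/
def powerSort : Stmt := block [
  .assign .s1 1,
  extendRunRight .s1 .e1,
  .while (.lt (Reg.e1 : Expr) (Reg.n : Expr)) (block [
    .assign .s2 ((Reg.e1 : Expr) + 1),
    extendRunRight .s2 .e2,
    nodePower,
    .while (.topPGt .p) (block [
      .popP,
      mergeTop]),
    .pushX .s1 .e1,
    .pushP .p,
    .assign .s1 Reg.s2,
    .assign .e1 Reg.e2]),
  .while .nonemptyX mergeTop]

/-- The configuration in which PowerSort starts on the array `A[1..n]`: the stacks are empty,
register `n` holds the length of the array, and the buffer has arbitrary contents `B`. -/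
def start {α : Type*} (A B : ℕ → α) (n : ℕ) : Config α :=
  ([powerSort],
    { reg := Function.update (fun _ => 0) Reg.n n
      X := []
      P := []
      arr := A
      buf := B
      comparisons := 0
      mergeCost := 0 })

end PowerSort

/-! Let neighbouring runs of lengths `n₁` and `n₂` have a boundary of power `p`. Their relative
midpoints are `(n₁ + n₂) / (2n)` apart and lie in the same dyadic interval of level `p - 1`. Hence
`2 ^ p * L ≤ 4 * n`, that is `p ≤ lg (n / L) + 2`, for either length `L` (`IsPower.mul_two_pow_lt`,
`mul_le_mul_logb_add_two`).

The merge cost is amortised. A stacked run weighs its length times the power of its right boundary;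
the run at hand weighs its length times the larger power of its two boundaries. A merge removes a
boundary of power `q` larger than the powers on both sides of the merged run, so every key involved
drops from weight `q` to at most `q - 1`, which pays for the merge (`wp_mergeTop_popping`). A push
changes no weight, and a run at hand never has to weigh more than `L * (lg (n / L) + 2)`. These
bounds add up to `ℋ n + 2n`.

The powers on the stack strictly increase towards the top. Equal powers are excluded by parity: at
level `p` the scaled midpoint left of the boundary has an even floor and the right one an odd floor
(`IsPower.mod_two`), whereas every stacked power gives the midpoint of the latest run an odd floor.
As powers lie in `[1, ⌊lg n⌋ + 1]`, this bounds the heights.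

Finding the runs takes at most `n - 1` comparisons, and each of the `r - 1` merges takes at least
one fewer than its cost. Cells right of the latest run are untouched, so the runs found are those of
the input; beyond that no array contents are tracked, since the bounds hold for any outcome of the
comparisons made while merging. -/

namespace PowerSort

/-! ### Weakest preconditions with a predicate that holds at every time -/

section Wp

variable {α : Type*} [LinearOrder α]

/-- Started in `σ`, the statement `s` terminates in a memory that satisfies `Q`, and `I` holds at
every time until then. -/
def Wp (I : Mem α → Prop) (s : Stmt) (Q : Mem α → Prop) (σ : Mem α) : Prop :=
  ∀ k : List Stmt, ∃ (T : ℕ) (τ : Mem α), step^[T] (s :: k, σ) = (k, τ) ∧ Q τ ∧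
    ∀ t ≤ T, I (step^[t] (s :: k, σ)).2

variable {I Q R : Mem α → Prop} {σ : Mem α}

theorem Wp.of_step {s : Stmt} {τ : Mem α} (h : ∀ k, step (s :: k, σ) = (k, τ)) (hI : I σ)
    (hI' : I τ) (hQ : Q τ) : Wp I s Q σ := by
  intro k
  refine ⟨1, τ, h k, hQ, fun t ht => ?_⟩
  interval_cases t
  · exact hI
  · simpa [h k] using hI'

theorem Wp.of_next {s : Stmt} {σ' : Mem α} (l : List Stmt)
    (h : ∀ k, step (s :: k, σ) = (l ++ k, σ')) (hI : I σ)
    (hw : ∀ k, ∃ (T : ℕ) (τ : Mem α), step^[T] (l ++ k, σ') = (k, τ) ∧ Q τ ∧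
      ∀ t ≤ T, I (step^[t] (l ++ k, σ')).2) : Wp I s Q σ := by
  intro k
  obtain ⟨T, τ, h1, h2, h3⟩ := hw k
  refine ⟨T + 1, τ, ?_, h2, fun t ht => ?_⟩
  · rw [Function.iterate_succ_apply, h k, h1]
  · cases t with
    | zero => exact hI
    | succ t =>
      rw [Function.iterate_succ_apply, h k]
      exact h3 t (by omega)

/-- Sequencing works because `Wp` quantifies over the continuation: `s` is run with `t :: k` still
to do. -/
theorem Wp.two {s t : Stmt} (hw : Wp I s (Wp I t Q) σ) (k : List Stmt) :
    ∃ (T : ℕ) (τ : Mem α), step^[T] (s :: t :: k, σ) = (k, τ) ∧ Q τ ∧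
      ∀ u ≤ T, I (step^[u] (s :: t :: k, σ)).2 := by
  obtain ⟨T, τ, h1, h2, h3⟩ := hw (t :: k)
  obtain ⟨T', τ', h1', h2', h3'⟩ := h2 k
  refine ⟨T' + T, τ', ?_, h2', fun u hu => ?_⟩
  · rw [Function.iterate_add_apply, h1, h1']
  · rcases le_total u T with h | h
    · exact h3 u h
    · obtain ⟨v, rfl⟩ := Nat.exists_eq_add_of_le' h
      rw [Function.iterate_add_apply, h1]
      exact h3' v (by omega)

theorem Wp.inv {s : Stmt} (h : Wp I s Q σ) : I σ := by
  obtain ⟨T, τ, -, -, h3⟩ := h []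
  exact h3 0 (Nat.zero_le _)

theorem Wp.mono {s : Stmt} (h : Wp I s Q σ) (hQ : ∀ τ, I τ → Q τ → R τ) : Wp I s R σ := by
  intro k
  obtain ⟨T, τ, h1, h2, h3⟩ := h k
  refine ⟨T, τ, h1, hQ τ ?_ h2, h3⟩
  simpa [h1] using h3 T le_rfl

theorem Wp.seq {s t : Stmt} (h : Wp I s (Wp I t Q) σ) : Wp I (.seq s t) Q σ :=
  Wp.of_next [s, t] (fun _ => rfl) h.inv fun k => h.two k

theorem Wp.skip (hI : I σ) (hQ : Q σ) : Wp I .skip Q σ :=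
  Wp.of_step (fun _ => rfl) hI hI hQ

theorem Wp.block_nil (hI : I σ) (hQ : Q σ) : Wp I (block []) Q σ :=
  Wp.skip hI hQ

theorem Wp.block_cons {s : Stmt} {l : List Stmt} (h : Wp I s (Wp I (block l) Q) σ) :
    Wp I (block (s :: l)) Q σ :=
  Wp.seq h

theorem Wp.ite {c : Test} {s t : Stmt} (hI : I σ) (hs : c.eval σ = true → Wp I s Q σ)
    (ht : c.eval σ = false → Wp I t Q σ) : Wp I (.ite c s t) Q σ := by
  cases h : c.eval σ with
  | true =>
    exact Wp.of_next [s] (fun k => by simp [step, h]) hI (hs h)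
  | false =>
    exact Wp.of_next [t] (fun k => by simp [step, h]) hI (ht h)

/-- The rule for loops, with an invariant `J` and a variant `μ`. -/
theorem Wp.while {c : Test} {s : Stmt} (J : Mem α → Prop) (μ : Mem α → ℕ) (hI : I σ) (hJ : J σ)
    (hs : ∀ σ, I σ → J σ → c.eval σ = true → Wp I s (fun τ => J τ ∧ μ τ < μ σ) σ)
    (hQ : ∀ σ, I σ → J σ → c.eval σ = false → Q σ) : Wp I (.while c s) Q σ := by
  induction hm : μ σ using Nat.strong_induction_on generalizing σ with
  | _ m ih =>
    cases h : c.eval σ with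
    | true =>
      refine Wp.of_next (σ' := σ) [s, .while c s] (fun k => by simp [step, h]) hI fun k => Wp.two ?_ k
      exact (hs σ hI hJ h).mono fun τ hτ hJτ => ih (μ τ) (hm ▸ hJτ.2) hτ hJτ.1 rfl
    | false =>
      exact Wp.of_step (fun k => by simp [step, h]) hI hI (hQ σ hI hJ h)

end Wp

/-! ### Evaluation of word expressions. -/

section Eval

variable (r : Reg → ℕ) (u v : Expr)

@[simp] theorem Expr.eval_zero : Expr.eval r 0 = 0 := rfl

@[simp] theorem Expr.eval_one : Expr.eval r 1 = 1 := rfl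

@[simp] theorem Expr.eval_two : Expr.eval r 2 = 2 := rfl

@[simp] theorem Expr.eval_hAdd : Expr.eval r (u + v) = u.eval r + v.eval r := rfl

@[simp] theorem Expr.eval_hSub : Expr.eval r (u - v) = u.eval r - v.eval r := rfl

@[simp] theorem Expr.eval_hDiv : Expr.eval r (u / v) = u.eval r / v.eval r := rfl

@[simp] theorem Expr.eval_reg (x : Reg) : Expr.eval r (.reg x) = r x := rfl

end Eval

/-! ### Memories with low stacks and small words -/

section Safe

variable {α : Type*}

/-- The stacks have height at most `H` and all words are at most `W`. -/
structure Safe (H W : ℕ) (σ : Mem α) : Prop where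
  X_length : σ.X.length ≤ H
  P_length : σ.P.length ≤ H
  reg : ∀ x, σ.reg x ≤ W
  X : ∀ q ∈ σ.X, q.1 ≤ W ∧ q.2 ≤ W
  P : ∀ q ∈ σ.P, q ≤ W

variable {H W : ℕ} {σ : Mem α}

@[simp] theorem Mem.set_reg (x y : Reg) (v : ℕ) :
    (σ.set x v).reg y = if y = x then v else σ.reg y := by
  simp [Mem.set, Function.update_apply]

@[simp] theorem Mem.set_X (x : Reg) (v : ℕ) : (σ.set x v).X = σ.X := rfl

@[simp] theorem Mem.set_P (x : Reg) (v : ℕ) : (σ.set x v).P = σ.P := rfl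

@[simp] theorem Mem.set_arr (x : Reg) (v : ℕ) : (σ.set x v).arr = σ.arr := rfl

@[simp] theorem Mem.set_comparisons (x : Reg) (v : ℕ) :
    (σ.set x v).comparisons = σ.comparisons := rfl

@[simp] theorem Mem.set_mergeCost (x : Reg) (v : ℕ) : (σ.set x v).mergeCost = σ.mergeCost := rfl

theorem Safe.set (h : Safe H W σ) {x : Reg} {v : ℕ} (hv : v ≤ W) : Safe H W (σ.set x v) :=
  ⟨h.X_length, h.P_length, fun y => by
    rw [Mem.set_reg]
    split_ifs
    exacts [hv, h.reg y], h.X, h.P⟩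

/-- Only the registers in `S` and the array up to position `h` have changed. -/
structure Frame (S : List Reg) (h : ℕ) (σ τ : Mem α) : Prop where
  reg : ∀ x ∉ S, τ.reg x = σ.reg x
  arr : ∀ i, h < i → τ.arr i = σ.arr i

/-- Only the registers in `S`, the array up to position `h`, the buffer and the number of
comparisons have changed. -/
structure Still (S : List Reg) (h : ℕ) (σ τ : Mem α) : Prop extends Frame S h σ τ where
  X : τ.X = σ.X
  P : τ.P = σ.P
  mergeCost : τ.mergeCost = σ.mergeCost

variable {S S' : List Reg} {h h' : ℕ} {ρ τ : Mem α}

theorem Still.refl (S : List Reg) (h : ℕ) (σ : Mem α) : Still S h σ σ :=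
  ⟨⟨fun _ _ => rfl, fun _ _ => rfl⟩, rfl, rfl, rfl⟩

theorem Still.trans (h₁ : Still S h ρ σ) (h₂ : Still S h σ τ) : Still S h ρ τ :=
  ⟨⟨fun x hx => (h₂.reg x hx).trans (h₁.reg x hx), fun i hi => (h₂.arr i hi).trans (h₁.arr i hi)⟩,
    h₂.X.trans h₁.X, h₂.P.trans h₁.P, h₂.mergeCost.trans h₁.mergeCost⟩

theorem Still.weaken (h₁ : Still S h σ τ) (hS : S ⊆ S') (hh : h ≤ h') : Still S' h' σ τ :=
  ⟨⟨fun x hx => h₁.reg x (fun hx' => hx (hS hx')), fun i hi => h₁.arr i (by omega)⟩,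
    h₁.X, h₁.P, h₁.mergeCost⟩

theorem Still.set (h₁ : Still S h ρ σ) {x : Reg} {v : ℕ} (hx : x ∈ S) :
    Still S h ρ (σ.set x v) :=
  ⟨⟨fun y hy => by
    rw [Mem.set_reg, if_neg (by rintro rfl; exact hy hx), h₁.reg y hy], h₁.arr⟩, h₁.X, h₁.P, h₁.mergeCost⟩

theorem Still.compare (h₁ : Still S h ρ σ) {n : ℕ} : Still S h ρ { σ with comparisons := n } :=
  ⟨⟨h₁.reg, h₁.arr⟩, h₁.X, h₁.P, h₁.mergeCost⟩

theorem Still.copy_buf (h₁ : Still S h ρ σ) {b : ℕ → α} : Still S h ρ { σ with buf := b } :=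
  ⟨⟨h₁.reg, h₁.arr⟩, h₁.X, h₁.P, h₁.mergeCost⟩

theorem Still.copy_arr (h₁ : Still S h ρ σ) {i : ℕ} {w : α} (hi : i ≤ h) :
    Still S h ρ { σ with arr := Function.update σ.arr i w } :=
  ⟨⟨h₁.reg, fun j hj => by
    simp only [Function.update_apply, if_neg (show j ≠ i by omega)]
    exact h₁.arr j hj⟩, h₁.X, h₁.P, h₁.mergeCost⟩

theorem Still.swap (h₁ : Still S h ρ σ) {i j : ℕ} (hi : i ≤ h) (hj : j ≤ h) :
    Still S h ρ { σ with arr := σ.arr ∘ Equiv.swap i j } :=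
  ⟨⟨h₁.reg, fun k hk => by
    simp only [Function.comp, Equiv.swap_apply_of_ne_of_ne (show k ≠ i by omega)
      (show k ≠ j by omega)]
    exact h₁.arr k hk⟩, h₁.X, h₁.P, h₁.mergeCost⟩

end Safe

/-! ### Rules for the primitive statements. -/

section Rules

variable {α : Type*} [LinearOrder α] {H W : ℕ} {Q : Mem α → Prop} {σ : Mem α}

theorem wp_assign {x : Reg} {u : Expr} (h : Safe H W σ) (hu : u.eval σ.reg ≤ W)
    (hQ : Safe H W (σ.set x (u.eval σ.reg)) → Q (σ.set x (u.eval σ.reg))) :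
    Wp (Safe H W) (.assign x u) Q σ :=
  Wp.of_step (fun _ => rfl) h (h.set hu) (hQ (h.set hu))

theorem wp_compare {x : Reg} {u v : Cell} (h : Safe H W σ) (hW : 1 ≤ W)
    (hQ : ∀ τ : Mem α, Safe H W τ →
      τ = { σ.set x (if σ.read u < σ.read v then 1 else 0) with
            comparisons := σ.comparisons + 1 } → Q τ) :
    Wp (Safe H W) (.compare x u v) Q σ := by
  have h1 : Safe H W (σ.set x (if σ.read u < σ.read v then 1 else 0)) :=
    h.set (by split_ifs <;> omega)
  have h2 : Safe H W { σ.set x (if σ.read u < σ.read v then 1 else 0) with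
            comparisons := σ.comparisons + 1 } := ⟨h1.1, h1.2, h1.3, h1.4, h1.5⟩
  exact Wp.of_step (fun _ => rfl) h h2 (hQ _ h2 rfl)

theorem wp_copy_buf {u : Expr} {v : Cell} (h : Safe H W σ)
    (hQ : ∀ τ : Mem α, Safe H W τ →
      τ = { σ with buf := Function.update σ.buf (u.eval σ.reg) (σ.read v) } → Q τ) :
    Wp (Safe H W) (.copy (.buf u) v) Q σ := by
  have h2 : Safe H W { σ with buf := Function.update σ.buf (u.eval σ.reg) (σ.read v) } :=
    ⟨h.1, h.2, h.3, h.4, h.5⟩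
  exact Wp.of_step (fun _ => rfl) h h2 (hQ _ h2 rfl)

theorem wp_copy_arr {u : Expr} {v : Cell} (h : Safe H W σ)
    (hQ : ∀ τ : Mem α, Safe H W τ →
      τ = { σ with arr := Function.update σ.arr (u.eval σ.reg) (σ.read v) } → Q τ) :
    Wp (Safe H W) (.copy (.arr u) v) Q σ := by
  have h2 : Safe H W { σ with arr := Function.update σ.arr (u.eval σ.reg) (σ.read v) } :=
    ⟨h.1, h.2, h.3, h.4, h.5⟩
  exact Wp.of_step (fun _ => rfl) h h2 (hQ _ h2 rfl)

theorem wp_swap {u v : Expr} (h : Safe H W σ)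
    (hQ : ∀ τ : Mem α, Safe H W τ →
      τ = { σ with arr := σ.arr ∘ Equiv.swap (u.eval σ.reg) (v.eval σ.reg) } → Q τ) :
    Wp (Safe H W) (.swap u v) Q σ := by
  have h2 : Safe H W { σ with arr := σ.arr ∘ Equiv.swap (u.eval σ.reg) (v.eval σ.reg) } :=
    ⟨h.1, h.2, h.3, h.4, h.5⟩
  exact Wp.of_step (fun _ => rfl) h h2 (hQ _ h2 rfl)

theorem wp_tally {u : Expr} (h : Safe H W σ)
    (hQ : ∀ τ : Mem α, Safe H W τ →
      τ = { σ with mergeCost := σ.mergeCost + u.eval σ.reg } → Q τ) :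
    Wp (Safe H W) (.tally u) Q σ := by
  have h2 : Safe H W { σ with mergeCost := σ.mergeCost + u.eval σ.reg } :=
    ⟨h.1, h.2, h.3, h.4, h.5⟩
  exact Wp.of_step (fun _ => rfl) h h2 (hQ _ h2 rfl)

theorem wp_pushX {x y : Reg} (h : Safe H W σ) (hH : σ.X.length + 1 ≤ H)
    (hQ : ∀ τ : Mem α, Safe H W τ →
      τ = { σ with X := (σ.reg x, σ.reg y) :: σ.X } → Q τ) :
    Wp (Safe H W) (.pushX x y) Q σ := by
  have h2 : Safe H W { σ with X := (σ.reg x, σ.reg y) :: σ.X } :=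
    ⟨hH, h.2, h.3, by simpa [h.reg] using fun a b => h.4 (a, b), h.5⟩
  exact Wp.of_step (fun _ => rfl) h h2 (hQ _ h2 rfl)

theorem wp_pushP {x : Reg} (h : Safe H W σ) (hH : σ.P.length + 1 ≤ H)
    (hQ : ∀ τ : Mem α, Safe H W τ → τ = { σ with P := σ.reg x :: σ.P } → Q τ) :
    Wp (Safe H W) (.pushP x) Q σ := by
  have h2 : Safe H W { σ with P := σ.reg x :: σ.P } :=
    ⟨h.1, hH, h.3, h.4, by simpa [h.reg] using h.5⟩
  exact Wp.of_step (fun _ => rfl) h h2 (hQ _ h2 rfl)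

theorem wp_popP (h : Safe H W σ)
    (hQ : ∀ τ : Mem α, Safe H W τ → τ = { σ with P := σ.P.tail } → Q τ) :
    Wp (Safe H W) .popP Q σ := by
  have h2 : Safe H W { σ with P := σ.P.tail } :=
    ⟨h.1, by have := h.2; simp; omega, h.3, h.4, fun q hq => h.5 q (List.mem_of_mem_tail hq)⟩
  exact Wp.of_step (fun _ => rfl) h h2 (hQ _ h2 rfl)

theorem wp_popX {x y : Reg} {l m : ℕ} {X : List (ℕ × ℕ)} (h : Safe H W σ)
    (hX : σ.X = (l, m) :: X)
    (hQ : ∀ τ : Mem α, Safe H W τ → τ = { (σ.set x l).set y m with X := X } → Q τ) :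
    Wp (Safe H W) (.popX x y) Q σ := by
  have h1 : Safe H W ((σ.set x l).set y m) :=
    (h.set (h.4 (l, m) (by simp [hX])).1).set (h.4 (l, m) (by simp [hX])).2
  have h2 : Safe H W { (σ.set x l).set y m with X := X } :=
    ⟨by have := h.1; simp [hX] at this; simp; omega, h1.2, h1.3,
      fun q hq => h.4 q (by simp [hX, hq]), h1.5⟩
  exact Wp.of_step (fun k => by simp [step, hX]) h h2 (hQ _ h2 rfl)

end Rules

/-! ### Specifications of the parts of the program -/

section Specs

variable {α : Type*} [LinearOrder α] {H W : ℕ} {Q : Mem α → Prop} {σ : Mem α}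

/-- Only locality matters here, not that the keys end up reversed. The register `i` is overwritten
before `e` is read, hence `e ≠ .i`. -/
theorem wp_reverse {s e : Reg} {h : ℕ} (hI : Safe H W σ) (hs : σ.reg s ≤ h) (he : σ.reg e ≤ h)
    (hei : e ≠ .i) (hh : h ≤ W)
    (hQ : ∀ τ, Safe H W τ → Still [.i, .j] h σ τ → τ.comparisons = σ.comparisons → Q τ) :
    Wp (Safe H W) (reverse s e) Q σ := by
  unfold reverse
  refine Wp.block_cons <| wp_assign hI (by simp; omega) fun hI => ?_
  refine Wp.block_cons <| wp_assign hI (by simp [hei]; omega) fun hI => ?_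
  refine Wp.block_cons ?_
  refine Wp.while (fun τ => Still [.i, .j] h σ τ ∧ τ.comparisons = σ.comparisons ∧
      τ.reg .i ≤ h ∧ τ.reg .j ≤ h) (fun τ => τ.reg .j - τ.reg .i) hI ?_ ?_ ?_
  · exact ⟨((Still.refl _ _ _).set (by simp)).set (by simp), rfl, by simpa using hs,
      by simpa [hei] using he⟩
  · rintro ρ hI ⟨h1, h2, h3, h4⟩ hc
    replace hc : ρ.reg .i < ρ.reg .j := of_decide_eq_true hc
    refine Wp.block_cons <| wp_swap hI fun τ hI hτ => ?_
    have h1' : Still [.i, .j] h σ τ := by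
      rw [hτ]; exact h1.swap h3 h4
    have hi : τ.reg .i = ρ.reg .i := by rw [hτ]
    have hj : τ.reg .j = ρ.reg .j := by rw [hτ]
    have hcmp : τ.comparisons = ρ.comparisons := by rw [hτ]
    refine Wp.block_cons <| wp_assign hI (by simp; omega) fun hI => ?_
    refine Wp.block_cons <| wp_assign hI (by simp; omega) fun hI => ?_
    refine Wp.block_nil hI ⟨⟨(h1'.set (by simp)).set (by simp), ?_, ?_, ?_⟩, ?_⟩ <;> simp <;> omega
  · rintro ρ hI ⟨h1, h2, h3, h4⟩ -
    exact Wp.block_nil hI (hQ _ hI h1 h2)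

/-- Whether the key at position `i` exceeds its right neighbour, as a word. -/
def descent (A : ℕ → α) (i : ℕ) : ℕ := if A (i + 1) < A i then 1 else 0

/-- The program detects the end of a run by comparing outcome bits, so runs are recast as intervals
on which these bits are constant. -/
theorem isRun_iff_descent {A : ℕ → α} {s e : ℕ} :
    IsRun A s e ↔ ∀ i, s ≤ i → i < e → descent A i = descent A s := by
  constructor
  · rintro (h | h) i hi he
    · have h1 := h i (by simp; omega)
      have h2 := h s (by simp; omega)
      simp [descent, h1.not_gt, h2.not_gt]
    · have h1 := h i (by simp; omega)
      have h2 := h s (by simp; omega)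
      simp [descent, h1, h2]
  · intro h
    by_cases hs : A (s + 1) < A s
    · refine Or.inr fun i hi => ?_
      simp at hi
      simpa [descent, hs] using h i hi.1 hi.2
    · refine Or.inl fun i hi => ?_
      simp at hi
      simpa [descent, hs] using h i hi.1 hi.2

theorem runEnd_le (A : ℕ → α) (n s : ℕ) : runEnd A n s ≤ n := Nat.findGreatest_le _

theorem runEnd_eq {A : ℕ → α} {n s e : ℕ} (hse : s ≤ e) (hen : e ≤ n)
    (h : ∀ i, s ≤ i → i < e → descent A i = descent A s)
    (hmax : e = n ∨ descent A e ≠ descent A s) : runEnd A n s = e := by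
  refine Nat.findGreatest_eq_iff.2 ⟨hen, fun _ => isRun_iff_descent.2 h, fun k hek hkn hk => ?_⟩
  rcases hmax with rfl | hmax
  · omega
  · exact hmax (isRun_iff_descent.1 hk e hse hek)

/-- A run of length `L` costs `L` comparisons, the last of which reveals its end, or `L - 1` if it
reaches the end of the array; hence the indicator. -/
theorem wp_extendRunRight {s e : Reg} {n : ℕ} {A : ℕ → α} (hI : Safe H W σ)
    (hs : s ∉ [.n, e, .c, .d, .i, .j]) (he : e ∉ [.n, .c, .d, .i, .j]) (hn : σ.reg .n = n)
    (hW : n ≤ W) (hs1 : 1 ≤ σ.reg s) (hsn : σ.reg s ≤ n)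
    (hA : ∀ i, σ.reg s ≤ i → σ.arr i = A i)
    (hQ : ∀ τ, Safe H W τ → Still [e, .c, .d, .i, .j] (τ.reg e) σ τ →
      τ.reg e = runEnd A n (σ.reg s) →
      τ.comparisons + (if τ.reg e = n then 1 else 0) ≤ σ.comparisons + (τ.reg e + 1 - σ.reg s) →
      Q τ) :
    Wp (Safe H W) (extendRunRight s e) Q σ := by
  simp only [List.mem_cons, List.not_mem_nil, or_false, not_or] at hs he
  obtain ⟨hsn', hse, hsc, hsd, hsi, hsj⟩ := hs
  obtain ⟨hen, hec, hed, hei, hej⟩ := he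
  generalize hs₀ : σ.reg s = s₀ at *
  unfold extendRunRight
  refine Wp.block_cons <| wp_assign hI (by simp; omega) fun hI => ?_
  refine Wp.block_cons <| Wp.ite hI (fun hc => ?_) (fun hc => ?_)
  · simp [Test.eval, hse, hs₀, Ne.symm hen, hn] at hc
    refine Wp.block_cons <| wp_compare hI (by omega) fun τ hI hτ => ?_
    have h1 : Still [e, .c, .d, .i, .j] 0 σ τ := by
      rw [hτ]
      exact (((Still.refl _ _ _).set (by simp)).set (by simp)).compare
    have hd : τ.reg .d = descent A s₀ := by
      rw [hτ]
      simp [Mem.read, hse, hs₀, descent, hA s₀ le_rfl, hA (s₀ + 1) (by omega)]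
    have hcmp : τ.comparisons = σ.comparisons + 1 := by rw [hτ]; rfl
    have hτs : τ.reg s = s₀ := by
      rw [h1.reg s (by simp [hse, hsc, hsd, hsi, hsj]), hs₀]
    clear hτ
    have hd1 : descent A s₀ ≤ 1 := by unfold descent; split_ifs <;> simp
    refine Wp.block_cons <| wp_assign hI (by simp; omega) fun hI => ?_
    refine Wp.block_cons <| wp_assign hI (by simp [Ne.symm hed]; omega) fun hI => ?_
    refine Wp.block_cons ?_
    -- Either every comparison so far extended the run, or the last one ended it and is the one
    -- extra comparison. The ending iteration leaves `e` fixed, so the variant also counts whether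
    -- `c` still agrees with `d`.
    refine Wp.while (fun ρ => Still [e, .c, .d, .i, .j] 0 σ ρ ∧ s₀ < ρ.reg e ∧ ρ.reg e ≤ n ∧
        ρ.reg .d = descent A s₀ ∧
        (∀ i, s₀ ≤ i → i < ρ.reg e → descent A i = descent A s₀) ∧
        ((ρ.reg .c = descent A s₀ ∧ ρ.comparisons + s₀ = σ.comparisons + ρ.reg e) ∨
         (ρ.reg .c ≠ descent A s₀ ∧ ρ.comparisons + s₀ = σ.comparisons + ρ.reg e + 1 ∧
          ρ.reg e < n ∧ descent A (ρ.reg e) ≠ descent A s₀)))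
      (fun ρ => (n - ρ.reg e) + (if ρ.reg .c = descent A s₀ then 1 else 0)) hI ?_ ?_ ?_
    · refine ⟨(h1.set (by simp)).set (by simp), ?_, ?_, ?_, ?_, Or.inl ⟨?_, ?_⟩⟩
      · simp [hec, hτs]
      · simp [hec, hτs]; omega
      · simp [Ne.symm hed, hd]
      · simp [hec, hτs]
        intro i h1 h2
        rw [show i = s₀ by omega]
      · simp [Ne.symm hed, hd]
      · simp [hec, hτs]; omega
    · rintro ρ hI ⟨h1, h2, h3, h4, h5, h6⟩ hc
      have hρn : ρ.reg .n = n := by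
        rw [h1.reg .n (by simp [Ne.symm hen]), hn]
      simp [Test.eval, hρn, h4] at hc
      obtain ⟨hc1, hc2⟩ := hc
      replace h6 : ρ.comparisons + s₀ = σ.comparisons + ρ.reg e := by
        rcases h6 with h | h
        · exact h.2
        · exact absurd hc2 h.1
      refine Wp.block_cons <| wp_compare hI (by omega) fun ν hI hν => ?_
      have h1' : Still [e, .c, .d, .i, .j] 0 σ ν := by
        rw [hν]
        exact (h1.set (by simp)).compare
      have hνc : ν.reg .c = descent A (ρ.reg e) := by
        rw [hν]
        simp [Mem.read, descent, h1.arr (ρ.reg e) (by omega), h1.arr (ρ.reg e + 1) (by omega),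
          hA (ρ.reg e) (by omega), hA (ρ.reg e + 1) (by omega)]
      have hcmp : ν.comparisons = ρ.comparisons + 1 := by rw [hν]
      have hνe : ν.reg e = ρ.reg e := by rw [hν]; simp [hec]
      have hνd : ν.reg .d = descent A s₀ := by rw [hν]; simp [h4]
      clear hν
      refine Wp.block_cons <| Wp.ite hI (fun hc => ?_) (fun hc => ?_)
      · simp [Test.eval, hνc, hνd] at hc
        refine wp_assign hI (by simp; omega) fun hI => ?_
        refine Wp.block_nil hI ⟨⟨h1'.set (by simp), ?_, ?_, ?_, ?_, Or.inl ⟨?_, ?_⟩⟩, ?_⟩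
        · simp; omega
        · simp; omega
        · simp [Ne.symm hed, hνd]
        · simp [hνe]
          intro i hi hi'
          rcases Nat.lt_or_eq_of_le (Nat.lt_succ_iff.1 (show i < (ρ.reg e).succ by omega)) with h | rfl
          · exact h5 i hi h
          · exact hc
        · simp [Ne.symm hec, hνc, hc]
        · simp; omega
        · simp [Ne.symm hec, hνc, hc, hc2]; omega
      · simp [Test.eval, hνc, hνd] at hc
        refine Wp.skip hI ?_
        refine Wp.block_nil hI ⟨⟨h1', ?_, ?_, ?_, ?_, Or.inr ⟨?_, ?_, ?_, ?_⟩⟩, ?_⟩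
        · omega
        · omega
        · exact hνd
        · rw [hνe]; exact h5
        · rw [hνc]; exact hc
        · omega
        · omega
        · rw [hνe]; exact hc
        · simp [hνe, hνc, hc, hc2]
    · rintro ρ hI ⟨h1, h2, h3, h4, h5, h6⟩ hc
      have hρn : ρ.reg .n = n := by
        rw [h1.reg .n (by simp [Ne.symm hen]), hn]
      have hρs : ρ.reg s = s₀ := by
        rw [h1.reg s (by simp [hse, hsc, hsd, hsi, hsj]), hs₀]
      simp [Test.eval, hρn, h4] at hc
      have hend : ρ.reg e = runEnd A n s₀ := by
        refine (runEnd_eq h2.le h3 h5 ?_).symm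
        rcases h6 with h | h
        · by_contra! hcon
          exact hc (by omega) h.1
        · exact Or.inr h.2.2.2
      have hcount : ρ.comparisons + (if ρ.reg e = n then 1 else 0) ≤
          σ.comparisons + (ρ.reg e + 1 - s₀) := by
        split_ifs with hif
        · rcases h6 with h | h <;> omega
        · rcases h6 with h | h <;> omega
      refine Wp.block_cons <| Wp.ite hI (fun hc => ?_) (fun hc => ?_)
      · refine wp_reverse (h := ρ.reg e) hI (by omega) le_rfl hei (by omega) fun τ hI hτ hcmp => ?_
        have hτe : τ.reg e = ρ.reg e := hτ.reg e (by simp [hei, hej])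
        refine Wp.block_nil hI <| Wp.block_nil hI <| hQ τ hI ?_ ?_ ?_
        · rw [hτe]
          exact (h1.weaken (List.Subset.refl _) (Nat.zero_le _)).trans
            (hτ.weaken (by simp) le_rfl)
        · rw [hτe, hend]
        · rw [hτe, hcmp]; exact hcount
      · refine Wp.skip hI ?_
        exact Wp.block_nil hI <| Wp.block_nil hI <|
          hQ ρ hI (h1.weaken (List.Subset.refl _) (Nat.zero_le _)) hend hcount
  · simp [Test.eval, hse, hs₀, Ne.symm hen, hn] at hc
    refine Wp.skip hI <| Wp.block_nil hI <| hQ _ hI ?_ ?_ ?_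
    · exact (Still.refl _ _ _).set (by simp)
    · simp [hs₀]
      exact (runEnd_eq le_rfl hsn (by omega) (by omega)).symm
    · simp [hs₀]
      split_ifs <;> omega

/-- The number `p` is the least `ℓ` such that `⌊u * 2 ^ ℓ⌋ ≠ ⌊v * 2 ^ ℓ⌋` for the relative positions
`u = a / (2 * n)` and `v = b / (2 * n)`. -/
structure IsPower (n a b p : ℕ) : Prop where
  ne : a * 2 ^ p / (n + n) ≠ b * 2 ^ p / (n + n)
  eq : ∀ l < p, a * 2 ^ l / (n + n) = b * 2 ^ l / (n + n)

/-- Numbers in the same block of length `N` differ by less than `N`. -/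
theorem mul_lt_of_div_eq {a b d N : ℕ} (hN : 0 < N) {c : ℕ} (h : a * c / N = b * c / N)
    (hd : b = a + d) : d * c < N := by
  subst hd
  have h1 := Nat.div_add_mod (a * c) N
  have h2 := Nat.div_add_mod ((a + d) * c) N
  have h3 := Nat.mod_lt ((a + d) * c) hN
  rw [← h] at h2
  have h4 : (a + d) * c = a * c + d * c := by ring
  omega

theorem wp_nodePower {n : ℕ} (hI : Safe H W σ) (hn : σ.reg .n = n) (h1 : 1 ≤ σ.reg .s1)
    (h2 : σ.reg .s1 ≤ σ.reg .e1) (h3 : σ.reg .s2 = σ.reg .e1 + 1) (h4 : σ.reg .s2 ≤ σ.reg .e2)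
    (h5 : σ.reg .e2 ≤ n) (hW : 4 * n * n ≤ W)
    (hQ : ∀ τ, Safe H W τ → Still [.p, .a, .b] 0 σ τ → τ.comparisons = σ.comparisons →
      IsPower n (σ.reg .s1 + σ.reg .e1 - 1) (σ.reg .s2 + σ.reg .e2 - 1) (τ.reg .p) → Q τ) :
    Wp (Safe H W) nodePower Q σ := by
  have hnW : 4 * n ≤ W := by nlinarith
  generalize ha : σ.reg .s1 + σ.reg .e1 - 1 = a at *
  generalize hb : σ.reg .s2 + σ.reg .e2 - 1 = b at *
  -- Midpoints in units of `1 / (2n)` are at least `2` apart, so equal floors force `2 ^ l < n`.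
  -- This gives termination and, as `b ≤ 2 * n`, the bound `4 * n * n` on the doubled registers.
  have key : ∀ l, a * 2 ^ l / (n + n) = b * 2 ^ l / (n + n) → 2 ^ l < n := by
    intro l hl
    have := mul_lt_of_div_eq (d := b - a) (by omega) hl (by omega)
    have : 2 * 2 ^ l ≤ (b - a) * 2 ^ l := Nat.mul_le_mul_right _ (by omega)
    omega
  unfold nodePower
  refine Wp.block_cons <| wp_assign hI (by simp) fun hI => ?_
  refine Wp.block_cons <| wp_assign hI (by simp; omega) fun hI => ?_
  refine Wp.block_cons <| wp_assign hI (by simp; omega) fun hI => ?_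
  refine Wp.block_cons ?_
  refine Wp.while (fun ρ => Still [.p, .a, .b] 0 σ ρ ∧ ρ.comparisons = σ.comparisons ∧
      ρ.reg .a = a * 2 ^ ρ.reg .p ∧ ρ.reg .b = b * 2 ^ ρ.reg .p ∧
      ∀ l < ρ.reg .p, a * 2 ^ l / (n + n) = b * 2 ^ l / (n + n))
    (fun ρ => n - ρ.reg .p) hI ?_ ?_ ?_
  · refine ⟨(((Still.refl _ _ _).set (by simp)).set (by simp)).set (by simp), rfl, ?_, ?_, ?_⟩ <;>
      simp <;> omega
  · rintro ρ hI ⟨r1, r2, r3, r4, r5⟩ hc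
    simp [Test.eval, r1.reg .n (by simp), hn, r3, r4] at hc
    have hlt := key _ hc
    have hp : ρ.reg .p < 2 ^ ρ.reg .p := Nat.lt_two_pow_self
    have hab : a ≤ b := by omega
    have hle : b * 2 ^ ρ.reg .p ≤ 2 * n * n := Nat.mul_le_mul (by omega) hlt.le
    have hle' : a * 2 ^ ρ.reg .p ≤ b * 2 ^ ρ.reg .p := Nat.mul_le_mul_right _ hab
    have hnn : 2 * n * n + 2 * n * n = 4 * n * n := by ring
    refine Wp.block_cons <| wp_assign hI (by simp [r3]; omega) fun hI => ?_
    refine Wp.block_cons <| wp_assign hI (by simp [r4]; omega) fun hI => ?_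
    refine Wp.block_cons <| wp_assign hI (by simp; omega) fun hI => ?_
    refine Wp.block_nil hI ⟨⟨((r1.set (by simp)).set (by simp)).set (by simp), r2, ?_, ?_, ?_⟩, ?_⟩
    · simp [r3]; ring
    · simp [r4]; ring
    · simp
      intro l hl
      rcases Nat.lt_or_eq_of_le (Nat.lt_succ_iff.1 (show l < (ρ.reg .p).succ by omega)) with h | rfl
      · exact r5 l h
      · exact hc
    · simp; omega
  · rintro ρ hI ⟨r1, r2, r3, r4, r5⟩ hc
    simp [Test.eval, r1.reg .n (by simp), hn, r3, r4] at hc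
    exact Wp.block_nil hI <| hQ ρ hI r1 r2 ⟨hc, r5⟩

/-- Each comparison places one key, and when one run is exhausted the other still has a key that is
placed without a comparison. This saves at least one comparison against the merge cost. -/
theorem wp_mergeTop {l m : ℕ} {X : List (ℕ × ℕ)} (hI : Safe H W σ) (hX : σ.X = (l, m) :: X)
    (hlm : l ≤ m) (hms : m + 1 = σ.reg .s1) (hse : σ.reg .s1 ≤ σ.reg .e1) (hW : σ.reg .e1 + 1 ≤ W)
    (hQ : ∀ τ, Safe H W τ → Frame [.l, .m, .i, .j, .k, .c, .s1] (σ.reg .e1) σ τ →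
      τ.reg .s1 = l → τ.X = X → τ.P = σ.P → τ.mergeCost = σ.mergeCost + (σ.reg .e1 + 1 - l) →
      τ.comparisons + 1 ≤ σ.comparisons + (σ.reg .e1 + 1 - l) → Q τ) :
    Wp (Safe H W) mergeTop Q σ := by
  generalize hs₀ : σ.reg .s1 = s at *
  generalize he₀ : σ.reg .e1 = e at *
  unfold mergeTop
  refine Wp.block_cons <| wp_popX hI hX fun σ₁ hI hσ₁ => ?_
  refine Wp.block_cons <| wp_tally hI fun σ₂ hI hσ₂ => ?_
  have f2 : Frame [.l, .m, .i, .j, .k, .c, .s1] e σ σ₂ := by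
    constructor
    · intro x hx
      simp only [List.mem_cons, List.not_mem_nil, or_false, not_or] at hx
      rw [hσ₂, hσ₁]; simp [hx]
    · rw [hσ₂, hσ₁]; simp
  have l2 : σ₂.reg .l = l := by rw [hσ₂, hσ₁]; simp
  have m2 : σ₂.reg .m = m := by rw [hσ₂, hσ₁]; simp
  have s2 : σ₂.reg .s1 = s := by rw [hσ₂, hσ₁]; simp [hs₀]
  have e2 : σ₂.reg .e1 = e := by rw [hσ₂, hσ₁]; simp [he₀]
  have X2 : σ₂.X = X := by rw [hσ₂, hσ₁]
  have P2 : σ₂.P = σ.P := by rw [hσ₂, hσ₁]; rfl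
  have mc2 : σ₂.mergeCost = σ.mergeCost + (e + 1 - l) := by
    rw [hσ₂, hσ₁]; simp [hs₀, he₀]; omega
  have c2 : σ₂.comparisons = σ.comparisons := by rw [hσ₂, hσ₁]; rfl
  clear hσ₂
  refine Wp.block_cons <| wp_assign hI (by simp; omega) fun hI => ?_
  refine Wp.block_cons ?_
  refine Wp.while (fun ρ => Still [.i, .j, .k, .c] e σ₂ ρ ∧ ρ.comparisons = σ₂.comparisons)
    (fun ρ => m + 1 - ρ.reg .i) hI ⟨(Still.refl _ _ _).set (by simp), rfl⟩ ?_ ?_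
  · rintro ρ hI ⟨r1, r2⟩ hc
    simp [Test.eval, r1.reg .m (by simp), m2] at hc
    refine Wp.block_cons <| wp_copy_buf hI fun τ hI hτ => ?_
    have t1 : Still [.i, .j, .k, .c] e σ₂ τ := by rw [hτ]; exact r1.copy_buf
    have ti : τ.reg .i = ρ.reg .i := by rw [hτ]
    have tc : τ.comparisons = ρ.comparisons := by rw [hτ]
    refine Wp.block_cons <| wp_assign hI (by simp; omega) fun hI => ?_
    refine Wp.block_nil hI ⟨⟨t1.set (by simp), ?_⟩, ?_⟩ <;> simp <;> omega
  rintro σ₃ hI ⟨f3, c3⟩ -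
  have l3 : σ₃.reg .l = l := by rw [f3.reg .l (by simp), l2]
  have s3 : σ₃.reg .s1 = s := by rw [f3.reg .s1 (by simp), s2]
  refine Wp.block_cons <| wp_assign hI (by simp; omega) fun hI => ?_
  refine Wp.block_cons <| wp_assign hI (by simp; omega) fun hI => ?_
  refine Wp.block_cons <| wp_assign hI (by simp; omega) fun hI => ?_
  refine Wp.block_cons ?_
  -- Exhausting both runs would mean `i + j = m + e + 2`; the last bound is one less and yields the
  -- saved comparison. The relation for `k` keeps all writes within `A[l..e]`.
  refine Wp.while (fun ρ => Still [.i, .j, .k, .c] e σ₂ ρ ∧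
      ρ.comparisons + l + s = σ.comparisons + ρ.reg .i + ρ.reg .j ∧
      ρ.reg .k + s = ρ.reg .i + ρ.reg .j ∧
      ρ.reg .i ≤ m + 1 ∧ ρ.reg .j ≤ e + 1 ∧ ρ.reg .i + ρ.reg .j ≤ m + e + 1)
    (fun ρ => m + e + 2 - (ρ.reg .i + ρ.reg .j)) hI ?_ ?_ ?_
  · refine ⟨((f3.set (by simp)).set (by simp)).set (by simp), ?_⟩
    simp
    omega
  · rintro ρ hI ⟨r1, r2, r3, r4, r5, r6⟩ hc
    simp [Test.eval, r1.reg .m (by simp), r1.reg .e1 (by simp), m2, e2] at hc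
    refine Wp.block_cons <| wp_compare hI (by omega) fun τ hI hτ => ?_
    have t1 : Still [.i, .j, .k, .c] e σ₂ τ := by rw [hτ]; exact (r1.set (by simp)).compare
    have ti : τ.reg .i = ρ.reg .i := by rw [hτ]; simp
    have tj : τ.reg .j = ρ.reg .j := by rw [hτ]; simp
    have tk : τ.reg .k = ρ.reg .k := by rw [hτ]; simp
    have tc : τ.comparisons = ρ.comparisons + 1 := by rw [hτ]
    clear hτ
    refine Wp.block_cons <| Wp.ite hI (fun _ => ?_) (fun _ => ?_)
    all_goals
      refine Wp.block_cons <| wp_copy_arr hI fun ν hI hν => ?_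
      have n1 : Still [.i, .j, .k, .c] e σ₂ ν := by
        rw [hν]
        exact t1.copy_arr (by simp; omega)
      have ni : ν.reg .i = ρ.reg .i := by rw [hν, ← ti]
      have nj : ν.reg .j = ρ.reg .j := by rw [hν, ← tj]
      have nk : ν.reg .k = ρ.reg .k := by rw [hν, ← tk]
      have nc : ν.comparisons = ρ.comparisons + 1 := by rw [hν, ← tc]
      clear hν
      refine Wp.block_cons <| wp_assign hI (by simp; omega) fun hI => ?_
      refine Wp.block_nil hI ?_
      refine Wp.block_cons <| wp_assign hI (by simp; omega) fun hI => ?_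
      refine Wp.block_nil hI ⟨⟨(n1.set (by simp)).set (by simp), ?_⟩, ?_⟩ <;> simp <;> omega
  rintro σ₄ hI ⟨f4, c4, k4, i4, j4, ij4⟩ -
  have hc4 : σ₄.comparisons + 1 ≤ σ.comparisons + (e + 1 - l) := by omega
  refine Wp.block_cons ?_
  refine Wp.while (fun ρ => Still [.i, .j, .k, .c] e σ₂ ρ ∧ ρ.comparisons = σ₄.comparisons ∧
      ρ.reg .k + s = ρ.reg .i + σ₄.reg .j)
    (fun ρ => m + 1 - ρ.reg .i) hI ⟨f4, rfl, k4⟩ ?_ ?_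
  · rintro ρ hI ⟨r1, r2, r3⟩ hc
    simp [Test.eval, r1.reg .m (by simp), m2] at hc
    refine Wp.block_cons <| wp_copy_arr hI fun τ hI hτ => ?_
    have t1 : Still [.i, .j, .k, .c] e σ₂ τ := by
      rw [hτ]
      exact r1.copy_arr (by simp; omega)
    have ti : τ.reg .i = ρ.reg .i := by rw [hτ]
    have tk : τ.reg .k = ρ.reg .k := by rw [hτ]
    have tc : τ.comparisons = ρ.comparisons := by rw [hτ]
    clear hτ
    refine Wp.block_cons <| wp_assign hI (by simp; omega) fun hI => ?_
    refine Wp.block_cons <| wp_assign hI (by simp; omega) fun hI => ?_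
    refine Wp.block_nil hI ⟨⟨(t1.set (by simp)).set (by simp), ?_⟩, ?_⟩ <;> simp <;> omega
  rintro σ₅ hI ⟨f5, c5, -⟩ -
  have l5 : σ₅.reg .l = l := by rw [f5.reg .l (by simp), l2]
  refine Wp.block_cons <| wp_assign hI (by simp; omega) fun hI => ?_
  refine Wp.block_nil hI <| hQ _ hI ⟨fun x hx => ?_, fun i hi => ?_⟩ ?_ ?_ ?_ ?_ ?_
  · have hx' := hx
    simp only [List.mem_cons, List.not_mem_nil, or_false, not_or] at hx
    rw [Mem.set_reg, if_neg (by tauto), f5.reg x (by simp; tauto), f2.reg x hx']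
  · rw [Mem.set_arr, f5.arr i hi, f2.arr i hi]
  · simp [l5]
  · exact f5.X.trans X2
  · exact f5.P.trans P2
  · exact f5.mergeCost.trans mc2
  · simp; omega

end Specs

/-! ### Powers -/

section Power

variable {n a b p : ℕ}

theorem IsPower.pos (h : IsPower n a b p) (ha : a < n + n) (hb : b < n + n) : 0 < p := by
  rcases Nat.eq_zero_or_pos p with rfl | hp
  · exact absurd (by simp [Nat.div_eq_of_lt ha, Nat.div_eq_of_lt hb]) h.ne
  · exact hp

theorem IsPower.mul_two_pow_lt (h : IsPower n a b p) (hp : 0 < p) (hab : a ≤ b) (hn : 0 < n) :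
    (b - a) * 2 ^ p < 4 * n := by
  obtain ⟨q, rfl⟩ := Nat.exists_eq_add_of_lt hp
  have := mul_lt_of_div_eq (d := b - a) (by omega) (h.eq q (by omega)) (by omega)
  have h2 : (b - a) * 2 ^ (0 + q + 1) = 2 * ((b - a) * 2 ^ q) := by ring
  omega

/-- Two nonempty runs have midpoints at least `2` units apart, so `2 * 2 ^ p < 4 * n`. -/
theorem IsPower.le_log (h : IsPower n a b p) (hp : 0 < p) (hab : a + 2 ≤ b) (hn : 0 < n) :
    p ≤ Nat.log 2 n + 1 := by
  have h1 := h.mul_two_pow_lt hp (by omega) hn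
  obtain ⟨q, rfl⟩ := Nat.exists_eq_add_of_lt hp
  have h2 : 2 * 2 ^ (0 + q + 1) ≤ (b - a) * 2 ^ (0 + q + 1) :=
    Nat.mul_le_mul_right _ (by omega)
  have h3 : 2 ^ (0 + q + 1) = 2 * 2 ^ q := by ring
  have := Nat.le_log_of_pow_le (b := 2) (x := q) (y := n) (by norm_num) (by omega)
  omega

theorem two_mul_div_eq_or {x N : ℕ} (hN : 0 < N) :
    2 * x / N = 2 * (x / N) ∨ 2 * x / N = 2 * (x / N) + 1 := by
  have h1 := Nat.div_add_mod x N
  have h2 := Nat.mod_lt x hN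
  have h3 : 2 * (x / N) ≤ 2 * x / N := by
    rw [Nat.le_div_iff_mul_le hN]; nlinarith [Nat.zero_le (x % N)]
  have h4 : 2 * x / N < 2 * (x / N) + 2 := by
    rw [Nat.div_lt_iff_lt_mul hN]; nlinarith
  omega

/-- Passing from level `p - 1` to `p` appends one binary digit to each floor. The floors agreed
before and differ now, and `a ≤ b`, so the digits are `0` and `1`. -/
theorem IsPower.mod_two (h : IsPower n a b p) (hp : 0 < p) (hab : a ≤ b) (hn : 0 < n) :
    a * 2 ^ p / (n + n) % 2 = 0 ∧ b * 2 ^ p / (n + n) % 2 = 1 := by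
  obtain ⟨q, rfl⟩ := Nat.exists_eq_add_of_lt hp
  have h1 := h.eq q (by omega)
  have h2 := h.ne
  have h3 : ∀ x : ℕ, x * 2 ^ (0 + q + 1) = 2 * (x * 2 ^ q) := fun x => by ring
  have h4 : a * 2 ^ (0 + q + 1) / (n + n) ≤ b * 2 ^ (0 + q + 1) / (n + n) :=
    Nat.div_le_div_right (Nat.mul_le_mul_right _ hab)
  rw [h3, h3] at h2 h4
  rw [h3, h3]
  have h5 := two_mul_div_eq_or (x := a * 2 ^ q) (N := n + n) (by omega)
  have h6 := two_mul_div_eq_or (x := b * 2 ^ q) (N := n + n) (by omega)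
  omega

theorem length_le_of_pairwise_gt {l : List ℕ} {h : ℕ} (hl : l.Pairwise (· > ·))
    (hb : ∀ q ∈ l, 1 ≤ q ∧ q ≤ h) : l.length ≤ h := by
  have hnd : l.Nodup := hl.imp fun h => (ne_of_gt h)
  rw [← List.toFinset_card_of_nodup hnd]
  calc l.toFinset.card ≤ (Finset.Icc 1 h).card :=
        Finset.card_le_card fun q hq => by simpa using hb q (by simpa using hq)
    _ = h := by simp

end Power

/-! ### Run lengths -/

section RunLengths

variable {α : Type*} [LinearOrder α]

theorem runLengthsFrom_of_le (A : ℕ → α) {n s : ℕ} (h : s ≤ n) :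
    runLengthsFrom A n s = (runEnd A n s + 1 - s) :: runLengthsFrom A n (runEnd A n s + 1) := by
  rw [runLengthsFrom, dif_pos h]
  have := le_runEnd A h
  congr 1
  omega

theorem runLengthsFrom_of_lt (A : ℕ → α) {n s : ℕ} (h : n < s) : runLengthsFrom A n s = [] := by
  rw [runLengthsFrom, dif_neg (by omega)]

theorem sum_runLengthsFrom (A : ℕ → α) (n s : ℕ) :
    (runLengthsFrom A n s).sum = n + 1 - s := by
  induction hm : n + 1 - s using Nat.strong_induction_on generalizing s with
  | _ m ih =>
    by_cases h : s ≤ n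
    · have h1 := le_runEnd A h
      have h2 := runEnd_le A n s
      rw [runLengthsFrom_of_le A h, List.sum_cons,
        ih (n + 1 - (runEnd A n s + 1)) (by omega) _ rfl]
      omega
    · rw [runLengthsFrom_of_lt A (by omega)]
      simp
      omega

/-- The sum of `L * (lg (n / L) + 2)` over a list of run lengths `L`. -/
noncomputable def costBound (n : ℕ) (l : List ℕ) : ℝ :=
  (l.map fun L : ℕ => (L : ℝ) * (Real.logb 2 (1 / ((L : ℝ) / n)) + 2)).sum

theorem costBound_nil (n : ℕ) : costBound n [] = 0 := by simp [costBound]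

theorem costBound_cons (n L : ℕ) (l : List ℕ) : costBound n (L :: l) =
    (L : ℝ) * (Real.logb 2 (1 / ((L : ℝ) / n)) + 2) + costBound n l := by simp [costBound]

theorem costBound_eq {n : ℕ} (hn : 0 < n) (l : List ℕ) :
    costBound n l = entropy (l.map fun L : ℕ => (L : ℝ) / n) * n + 2 * l.sum := by
  have hn' : (n : ℝ) ≠ 0 := by positivity
  induction l with
  | nil => simp [costBound, entropy]
  | cons L l ih =>
    rw [costBound_cons, ih]
    simp only [entropy, List.map_cons, List.sum_cons, List.map_map, Nat.cast_add]
    field_simp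
    ring

/-- Taking logarithms of `2 ^ q ≤ 4 * (n / L)`; the factor `4` is the source of the term `2n` in the
merge cost. -/
theorem mul_le_mul_logb_add_two {n L q : ℕ} (hn : 0 < n) (hL : 0 < L) (h : 2 ^ q * L ≤ 4 * n) :
    ((L * q : ℕ) : ℝ) ≤ (L : ℝ) * (Real.logb 2 (1 / ((L : ℝ) / n)) + 2) := by
  have hn' : (0 : ℝ) < n := by positivity
  have hL' : (0 : ℝ) < L := by positivity
  have h' : (2 : ℝ) ^ q * L ≤ 4 * n := by exact_mod_cast h
  have h1 : (q : ℝ) ≤ Real.logb 2 (4 * (n / L)) := by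
    rw [Real.le_logb_iff_rpow_le (by norm_num) (by positivity), Real.rpow_natCast,
      ← mul_div_assoc, le_div_iff₀ hL']
    exact h'
  have h2 : Real.logb 2 (4 : ℝ) = 2 := by
    rw [show (4 : ℝ) = 2 ^ (2 : ℝ) by norm_num, Real.logb_rpow (by norm_num) (by norm_num)]
  rw [Real.logb_mul (by norm_num) (by positivity), h2] at h1
  push_cast
  rw [one_div_div]
  gcongr
  linarith

end RunLengths

/-! ### Stacks -/

/-- The stack `X` holds adjacent runs that end right before position `s`. -/
def Adjacent : ℕ → List (ℕ × ℕ) → Prop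
  | _, [] => True
  | s, (l, m) :: X => 1 ≤ l ∧ l ≤ m ∧ m + 1 = s ∧ Adjacent l X

/-- The total length of the runs on the stack `X`, weighted with the powers on the stack `P`. -/
def weight (X : List (ℕ × ℕ)) (P : List ℕ) : ℕ :=
  (List.zipWith (fun q p => (q.2 + 1 - q.1) * p) X P).sum

theorem weight_cons (q : ℕ × ℕ) (p : ℕ) (X : List (ℕ × ℕ)) (P : List ℕ) :
    weight (q :: X) (p :: P) = (q.2 + 1 - q.1) * p + weight X P := by simp [weight]

/-! ### Amortisation of a single merge. -/

section Merging

variable {α : Type*} [LinearOrder α]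

/-- The state while runs are popped: `A[s1..e]` is the run at hand, `p` is the power of the boundary
to its right, `Q` are the powers of the boundaries between the runs on `X` and it, `M` bounds the
merge cost, and `c` and `d` are offsets that relate comparisons to merge cost. -/
structure Popping (e p M c d : ℕ) (Q : List ℕ) (σ : Mem α) : Prop where
  e1 : σ.reg .e1 = e
  s1_pos : 1 ≤ σ.reg .s1
  s1_le : σ.reg .s1 ≤ e
  adjacent : Adjacent (σ.reg .s1) σ.X
  length : σ.X.length = Q.length
  sorted : Q.Pairwise (· > ·)
  cost : σ.mergeCost + weight σ.X Q + (e + 1 - σ.reg .s1) * max (Q.headD 0) p ≤ M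
  comparisons : σ.comparisons + c ≤ σ.mergeCost + σ.X.length + d

variable {H W e p M c d q : ℕ} {Q : List ℕ} {σ : Mem α} {R : Mem α → Prop}

/-- Both merged runs weigh `q` per key before the merge and at most `q - 1` after it. The list `q ::
Q` need not be the stack `P`, because the main loop pops `P` before merging and the final loop never
pops it. -/
theorem wp_mergeTop_popping (hI : Safe H W σ) (h : Popping e p M c d (q :: Q) σ) (hpq : p < q)
    (hW : e + 1 ≤ W)
    (hR : ∀ τ, Safe H W τ → Frame [.l, .m, .i, .j, .k, .c, .s1] e σ τ → τ.P = σ.P →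
      τ.X.length < σ.X.length → Popping e p M c d Q τ → R τ) :
    Wp (Safe H W) mergeTop R σ := by
  obtain ⟨he, hs1, hse, hadj, hlen, hsort, hcost, hcmp⟩ := h
  rcases hX : σ.X with _ | ⟨⟨l, m⟩, X⟩
  · simp [hX] at hlen
  rw [hX] at hadj hlen hcost hcmp
  obtain ⟨a1, a2, a3, a4⟩ := hadj
  refine wp_mergeTop hI hX a2 a3 (by omega) (by omega) fun τ hI hF ts tX tP tm tc => ?_
  rw [he] at hF tm tc
  refine hR τ hI hF tP (by simp [tX, hX]) ⟨?_, ?_, ?_, ?_, ?_, ?_, ?_, ?_⟩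
  · rw [hF.reg .e1 (by simp), he]
  · omega
  · omega
  · rwa [ts, tX]
  · simpa [tX] using hlen
  · exact hsort.of_cons
  · have hmax : max (Q.headD 0) p + 1 ≤ q := by
      cases Q with
      | nil => simpa using hpq
      | cons q' Q =>
        have := hsort
        simp at this
        simp
        omega
    rw [weight_cons] at hcost
    simp only [List.headD_cons, max_eq_left hpq.le] at hcost
    rw [tm, tX, ts]
    have h1 : (e + 1 - l) * (max (Q.headD 0) p + 1) ≤ (e + 1 - l) * q :=
      Nat.mul_le_mul_left _ hmax
    have h2 : (m + 1 - l) * q + (e + 1 - σ.reg .s1) * q = (e + 1 - l) * q := by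
      rw [← Nat.add_mul]
      congr 1
      omega
    rw [Nat.mul_add] at h1
    omega
  · rw [tm, tX]
    simp at hcmp
    omega

end Merging

/-! ### The main loop -/

section MainLoop

variable {α : Type*} [LinearOrder α]

/-- The state at the head of the main loop: `A[s1..e1]` is the run found last. -/
structure Scanning (A : ℕ → α) (n : ℕ) (σ : Mem α) : Prop where
  n_eq : σ.reg .n = n
  s1_pos : 1 ≤ σ.reg .s1
  s1_le : σ.reg .s1 ≤ σ.reg .e1
  e1_le : σ.reg .e1 ≤ n
  e1 : σ.reg .e1 = runEnd A n (σ.reg .s1)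
  arr : ∀ i, σ.reg .e1 < i → σ.arr i = A i
  adjacent : Adjacent (σ.reg .s1) σ.X
  length : σ.X.length = σ.P.length
  sorted : σ.P.Pairwise (· > ·)
  range : ∀ q ∈ σ.P, 1 ≤ q ∧ q ≤ Nat.log 2 n + 1
  -- This parity rules out a repeated power at the next boundary.
  odd : ∀ q ∈ σ.P, (σ.reg .s1 + σ.reg .e1 - 1) * 2 ^ q / (n + n) % 2 = 1
  small : ∀ q ∈ σ.P, 2 ^ q * (σ.reg .e1 + 1 - σ.reg .s1) ≤ 4 * n
  cost : ((σ.mergeCost + weight σ.X σ.P : ℕ) : ℝ) + costBound n (runLengthsFrom A n (σ.reg .s1)) ≤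
    costBound n (runLengths A n)
  -- The number of merges so far is the number of runs found, minus one, minus the height of `X`;
  -- each merge has saved a comparison.
  comparisons : σ.comparisons + (if σ.reg .e1 = n then 1 else 0) + (runLengths A n).length ≤
    σ.mergeCost + σ.reg .e1 + (runLengthsFrom A n (σ.reg .e1 + 1)).length + 1 + σ.X.length

/-- The body of the main loop of `powerSort`. -/
def mainLoopBody : Stmt := block [
  .assign .s2 ((Reg.e1 : Expr) + 1),
  extendRunRight .s2 .e2,
  nodePower,
  .while (.topPGt .p) (block [
    .popP,
    mergeTop]),
  .pushX .s1 .e1,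
  .pushP .p,
  .assign .s1 Reg.s2,
  .assign .e1 Reg.e2]

theorem lt_of_pairwise_gt {P : List ℕ} {p : ℕ} (hP : P.Pairwise (· > ·)) (hh : P.headD 0 ≤ p)
    (hp : p ∉ P) : ∀ q ∈ P, q < p := by
  cases P with
  | nil => simp
  | cons r P =>
    simp at hP hh hp ⊢
    refine ⟨by omega, fun q hq => ?_⟩
    have := hP.1 q hq
    omega

theorem wp_mainLoopBody {A : ℕ → α} {n W : ℕ} {σ : Mem α} (hW : 4 * n * n ≤ W)
    (hI : Safe (Nat.log 2 n + 1) W σ) (h : Scanning A n σ) (hlt : σ.reg .e1 < n) :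
    Wp (Safe (Nat.log 2 n + 1) W) mainLoopBody
      (fun τ => Scanning A n τ ∧ n - τ.reg .e1 < n - σ.reg .e1) σ := by
  obtain ⟨hn, hs1, hse, hen, he, harr, hadj, hlen, hsort, hrange, hodd, hsmall, hcost, hcmp⟩ := h
  have hnW : 4 * n ≤ W := by nlinarith
  generalize hs₀ : σ.reg .s1 = s at *
  generalize he₀ : σ.reg .e1 = e at *
  unfold mainLoopBody
  refine Wp.block_cons <| wp_assign hI (by simp; omega) fun hI => ?_
  refine Wp.block_cons <| wp_extendRunRight (A := A) (n := n) hI (by simp) (by simp)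
    (by simpa using hn) (by omega) (by simp) (by simp; omega)
    (fun i hi => harr i (by simp [he₀] at hi; omega)) fun σ₁ hI f₁ end₁ c₁ => ?_
  simp [he₀] at end₁ c₁
  have hf := runEnd_le A n (e + 1)
  have hf' := le_runEnd A (n := n) (s := e + 1) (by omega)
  rw [← end₁] at hf hf'
  generalize hf₀ : σ₁.reg .e2 = f at *
  have n₁ : σ₁.reg .n = n := by rw [f₁.reg .n (by simp)]; simpa using hn
  have s1₁ : σ₁.reg .s1 = s := by rw [f₁.reg .s1 (by simp)]; simpa using hs₀
  have e1₁ : σ₁.reg .e1 = e := by rw [f₁.reg .e1 (by simp)]; simpa using he₀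
  have s2₁ : σ₁.reg .s2 = e + 1 := by rw [f₁.reg .s2 (by simp)]; simp [he₀]
  refine Wp.block_cons <| wp_nodePower hI n₁ (by omega) (by omega) (by omega) (by omega)
    (by omega) hW fun σ₂ hI f₂ c₂ hpow => ?_
  rw [s1₁, e1₁, s2₁, hf₀] at hpow
  generalize hp₀ : σ₂.reg .p = p at *
  have hp := hpow.pos (by omega) (by omega)
  have hplog := hpow.le_log hp (by omega) (by omega)
  have hplt := hpow.mul_two_pow_lt hp (by omega) (by omega)
  have hpmod := hpow.mod_two hp (by omega) (by omega)
  have X₂ : σ₂.X = σ.X := f₂.X.trans f₁.X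
  have P₂ : σ₂.P = σ.P := f₂.P.trans f₁.P
  have m₂ : σ₂.mergeCost = σ.mergeCost := f₂.mergeCost.trans f₁.mergeCost
  have s1₂ : σ₂.reg .s1 = s := by rw [f₂.reg .s1 (by simp), s1₁]
  have hrest := runLengthsFrom_of_le A (n := n) (s := e + 1) (by omega)
  rw [← end₁] at hrest
  -- The run at hand now trades its share of the entropy bound for its actual weight; the left power
  -- is covered by `hsmall`, the right one by `hplt`.
  set M := σ.mergeCost + weight σ.X σ.P + (e + 1 - s) * max (σ.P.headD 0) p with hM
  have hcostM : (M : ℝ) + costBound n (runLengthsFrom A n (e + 1)) ≤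
      costBound n (runLengths A n) := by
    rw [runLengthsFrom_of_le A (by omega), ← he, costBound_cons] at hcost
    have : 2 ^ max (σ.P.headD 0) p * (e + 1 - s) ≤ 4 * n := by
      rcases max_choice (σ.P.headD 0) p with hm | hm
      · rw [hm]
        cases hP : σ.P with
        | nil => simp; omega
        | cons q P => exact hsmall q (by simp [hP])
      · rw [hm]
        have : (e + 1 - s) * 2 ^ p ≤ (e + 1 + f - 1 - (s + e - 1)) * 2 ^ p :=
          Nat.mul_le_mul_right _ (by omega)
        rw [Nat.mul_comm]
        omega
    have := mul_le_mul_logb_add_two (by omega) (by omega) this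
    rw [hM, Nat.cast_add]
    linarith
  -- The offset `2`, against `1` in `Scanning`, arises because the next run is already found while
  -- the run at hand is not yet on `X`.
  refine Wp.block_cons <| Wp.while (fun ρ => Popping e p M
      ((if f = n then 1 else 0) + (runLengths A n).length)
      (f + (runLengthsFrom A n (f + 1)).length + 2) ρ.P ρ ∧ (∀ q ∈ ρ.P, q ∈ σ.P) ∧
      ρ.reg .n = n ∧ ρ.reg .s2 = e + 1 ∧ ρ.reg .e2 = f ∧ ρ.reg .p = p ∧
      ∀ i, f < i → ρ.arr i = A i) (fun ρ => ρ.X.length) hI ?_ ?_ ?_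
  · refine ⟨⟨?_, ?_, ?_, ?_, ?_, ?_, ?_, ?_⟩, ?_, ?_, ?_, ?_, hp₀, ?_⟩
    · rw [f₂.reg .e1 (by simp), e1₁]
    · omega
    · omega
    · rwa [s1₂, X₂]
    · rwa [X₂, P₂]
    · rwa [P₂]
    · rw [X₂, P₂, m₂, s1₂]
    · rw [hrest, List.length_cons, if_neg (by omega)] at hcmp
      rw [X₂, m₂, c₂]
      omega
    · rw [P₂]; exact fun q => id
    · rw [f₂.reg .n (by simp), n₁]
    · rw [f₂.reg .s2 (by simp), s2₁]
    · rw [f₂.reg .e2 (by simp), hf₀]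
    · intro i hi
      rw [f₂.arr i (by omega), f₁.arr i hi]
      exact harr i (by omega)
  · rintro ρ hI ⟨h1, h2, h3, h4, h5, h6, h7⟩ hc
    rcases hP : ρ.P with _ | ⟨q, P⟩
    · simp [Test.eval, hP] at hc
    simp [Test.eval, hP, h6] at hc
    refine Wp.block_cons <| wp_popP hI fun ν hI hν => ?_
    have hνP : ν.P = P := by rw [hν, hP]; rfl
    have h1' : Popping e p M ((if f = n then 1 else 0) + (runLengths A n).length)
        (f + (runLengthsFrom A n (f + 1)).length + 2) (q :: P) ν := by
      rw [hP] at h1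
      rw [hν]
      exact ⟨h1.1, h1.2, h1.3, h1.4, h1.5, h1.6, h1.7, h1.8⟩
    refine Wp.block_cons <| wp_mergeTop_popping hI h1' hc (by omega) fun τ hI hF tP tX h1 => ?_
    rw [hνP] at tP
    refine Wp.block_nil hI ⟨⟨?_, ?_, ?_, ?_, ?_, ?_, ?_⟩, ?_⟩
    · rwa [tP]
    · rw [tP]
      exact fun r hr => h2 r (by simp [hP, hr])
    · rw [hF.reg _ (by simp), hν, h3]
    · rw [hF.reg _ (by simp), hν, h4]
    · rw [hF.reg _ (by simp), hν, h5]
    · rw [hF.reg _ (by simp), hν, h6]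
    · intro i hi
      rw [hF.arr i (by omega), hν]
      exact h7 i hi
    · rw [hν] at tX
      exact tX
  rintro ρ hI ⟨h1, h2, h3, h4, h5, h6, h7⟩ hc
  have hhead : ρ.P.headD 0 ≤ p := by
    rcases hP : ρ.P with _ | ⟨q, P⟩
    · simp
    · simpa [Test.eval, hP, h6] using hc
  have hltp : ∀ q ∈ ρ.P, q < p := by
    -- A stacked power equal to `p` would make the left midpoint's floor at level `p` odd, but it is
    -- even.
    refine lt_of_pairwise_gt h1.sorted hhead fun hmem => ?_
    have := hodd p (h2 p hmem)
    omega
  have hsort' : (p :: ρ.P).Pairwise (· > ·) := List.pairwise_cons.2 ⟨hltp, h1.sorted⟩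
  have hrange' : ∀ q ∈ p :: ρ.P, 1 ≤ q ∧ q ≤ Nat.log 2 n + 1 := by
    rw [List.forall_mem_cons]
    exact ⟨⟨hp, hplog⟩, fun q hq => hrange q (h2 q hq)⟩
  have hheight := length_le_of_pairwise_gt hsort' hrange'
  rw [List.length_cons] at hheight
  refine Wp.block_cons <| wp_pushX hI (by rw [h1.length]; exact hheight) fun σ₃ hI hσ₃ => ?_
  refine Wp.block_cons <| wp_pushP hI (by rw [hσ₃]; exact hheight) fun σ₄ hI hσ₄ => ?_
  have r₄ : σ₄.reg = ρ.reg := by rw [hσ₄, hσ₃]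
  have X₄ : σ₄.X = (ρ.reg .s1, e) :: ρ.X := by rw [hσ₄, hσ₃, h1.e1]
  have P₄ : σ₄.P = p :: ρ.P := by rw [hσ₄, hσ₃, h6]
  have m₄ : σ₄.mergeCost = ρ.mergeCost := by rw [hσ₄, hσ₃]
  have c₄ : σ₄.comparisons = ρ.comparisons := by rw [hσ₄, hσ₃]
  have a₄ : σ₄.arr = ρ.arr := by rw [hσ₄, hσ₃]
  clear hσ₃ hσ₄
  refine Wp.block_cons <| wp_assign hI (by simp [r₄]; omega) fun hI => ?_
  refine Wp.block_cons <| wp_assign hI (by simp [r₄]; omega) fun hI => ?_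
  -- No stacked power exceeds `p`, so the run at hand already has the weight it carries on the
  -- stack.
  have hpop := h1.cost
  rw [max_eq_right hhead] at hpop
  refine Wp.block_nil hI ⟨⟨?_, ?_, ?_, ?_, ?_, ?_, ?_, ?_, ?_, ?_, ?_, ?_, ?_, ?_⟩, ?_⟩
  · simp [r₄, h3]
  · simp [r₄, h4]
  · simp [r₄, h4, h5]; omega
  · simp [r₄, h5]; omega
  · simp [r₄, h4, h5, end₁]
  · simpa [r₄, h5, a₄] using h7
  · simp [r₄, h4, X₄]
    exact ⟨h1.s1_pos, h1.s1_le, rfl, h1.adjacent⟩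
  · simp [X₄, P₄, h1.length]
  · simpa only [Mem.set_P, P₄] using hsort'
  · simpa only [Mem.set_P, P₄] using hrange'
  · simp only [Mem.set_P, P₄]
    simp [r₄, h4, h5]
    have hef : e + 1 + f - 1 = e + f := by omega
    rw [← hef]
    refine ⟨hpmod.2, fun q hq => ?_⟩
    -- Below level `p` the two midpoints have equal floors, so oddness passes to the new run.
    rw [← hpow.eq q (hltp q hq)]
    exact hodd q (h2 q hq)
  · have hbig : 2 ^ p * (f + 1 - (e + 1)) ≤ 4 * n := by
      have : (f + 1 - (e + 1)) * 2 ^ p ≤ (e + 1 + f - 1 - (s + e - 1)) * 2 ^ p :=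
        Nat.mul_le_mul_right _ (by omega)
      rw [Nat.mul_comm]
      omega
    simp only [Mem.set_P, P₄]
    simp [r₄, h4, h5]
    rw [Nat.add_sub_add_right] at hbig
    exact ⟨hbig, fun q hq => (Nat.mul_le_mul_right _
      (Nat.pow_le_pow_right (by norm_num) (hltp q hq).le)).trans hbig⟩
  · simp only [Mem.set_P, Mem.set_X, P₄, X₄, Mem.set_mergeCost, m₄, weight_cons]
    simp only [Expr.eval_reg, Mem.set_reg, r₄, h4, reduceCtorEq, if_true, if_false]
    refine le_trans ?_ hcostM
    gcongr
    omega
  · have := h1.comparisons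
    simp [r₄, h5, X₄, m₄, c₄]
    omega
  · simp [r₄, h5]; omega

theorem wp_powerSort {A B : ℕ → α} {n W : ℕ} (hn : 1 ≤ n) (hW : 4 * n * n ≤ W) :
    Wp (Safe (Nat.log 2 n + 1) W) powerSort
      (fun τ => (τ.mergeCost : ℝ) ≤ costBound n (runLengths A n) ∧
        τ.comparisons + (runLengths A n).length ≤ τ.mergeCost + n) (start A B n).2 := by
  have hnW : 4 * n ≤ W := by nlinarith
  generalize hσ₀ : (start A B n).2 = σ
  have rn : σ.reg .n = n := by rw [← hσ₀]; simp [start]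
  have hI : Safe (Nat.log 2 n + 1) W σ := by
    rw [← hσ₀]
    refine ⟨by simp [start], by simp [start], fun x => ?_, by simp [start], by simp [start]⟩
    simp [start, Function.update_apply]
    split_ifs <;> omega
  have hX : σ.X = [] := by rw [← hσ₀]; rfl
  have hP : σ.P = [] := by rw [← hσ₀]; rfl
  have ha : σ.arr = A := by rw [← hσ₀]; rfl
  have hc : σ.comparisons = 0 := by rw [← hσ₀]; rfl
  have hm : σ.mergeCost = 0 := by rw [← hσ₀]; rfl
  clear hσ₀
  unfold powerSort
  rw [← mainLoopBody]
  refine Wp.block_cons <| wp_assign hI (by simp; omega) fun hI => ?_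
  refine Wp.block_cons <| wp_extendRunRight (A := A) (n := n) hI (by simp) (by simp)
    (by simpa using rn) (by omega) (by simp) (by simpa using hn)
    (fun i _ => by simp [ha]) fun σ₁ hI f₁ end₁ c₁ => ?_
  simp at end₁ c₁
  have s₁ : σ₁.reg .s1 = 1 := by rw [f₁.reg .s1 (by simp)]; simp
  have hX₁ : σ₁.X = [] := f₁.X.trans hX
  have hP₁ : σ₁.P = [] := f₁.P.trans hP
  have hm₁ : σ₁.mergeCost = 0 := f₁.mergeCost.trans hm
  refine Wp.block_cons <| Wp.while (Scanning A n) (fun ρ => n - ρ.reg .e1) hI ?_ ?_ ?_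
  · refine ⟨?_, ?_, ?_, ?_, ?_, ?_, ?_, ?_, ?_, ?_, ?_, ?_, ?_, ?_⟩
    · rw [f₁.reg .n (by simp)]; simpa using rn
    · omega
    · rw [s₁, end₁]; exact le_runEnd A hn
    · rw [end₁]; exact runEnd_le A n 1
    · rw [s₁, end₁]
    · intro i hi
      rw [f₁.arr i hi, Mem.set_arr, ha]
    · rw [hX₁]; trivial
    · rw [hX₁, hP₁]; rfl
    all_goals try simp only [hP₁, List.Pairwise.nil, List.not_mem_nil, false_imp_iff, implies_true]
    · rw [hm₁, hX₁, s₁, runLengths]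
      simp [weight]
    · rw [hm₁, hX₁, end₁, runLengths, runLengthsFrom_of_le A hn]
      rw [end₁, hc] at c₁
      simp
      omega
  · intro ρ hI h hc
    simp [Test.eval, h.n_eq] at hc
    exact wp_mainLoopBody hW hI h hc
  intro σ₂ hI h hc
  simp [Test.eval, h.n_eq] at hc
  have he : σ₂.reg .e1 = n := le_antisymm h.e1_le hc
  have hrest : runLengthsFrom A n (n + 1) = [] := runLengthsFrom_of_lt A (by omega)
  set M := σ₂.mergeCost + weight σ₂.X σ₂.P + (n + 1 - σ₂.reg .s1) * max (σ₂.P.headD 0) 0 with hM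
  have hcostM : (M : ℝ) ≤ costBound n (runLengths A n) := by
    have hcost := h.cost
    have hs := h.s1_le
    rw [runLengthsFrom_of_le A (by omega), ← h.e1, he, costBound_cons, hrest, costBound_nil]
      at hcost
    have : 2 ^ max (σ₂.P.headD 0) 0 * (n + 1 - σ₂.reg .s1) ≤ 4 * n := by
      cases hP : σ₂.P with
      | nil => simp; omega
      | cons q P => simpa [he] using h.small q (by simp [hP])
    have := mul_le_mul_logb_add_two (by omega) (by omega) this
    rw [hM, Nat.cast_add]
    linarith
  -- The end of the array acts as a boundary of power `0`, below every stacked power, so the same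
  -- amortisation empties `X`. `Q` is a virtual copy of `P` that shrinks with `X`.
  refine Wp.block_cons <| Wp.while (fun ρ => ∃ Q : List ℕ, (∀ q ∈ Q, 1 ≤ q) ∧
      Popping n 0 M (runLengths A n).length n Q ρ) (fun ρ => ρ.X.length) hI ?_ ?_ ?_
  · refine ⟨σ₂.P, fun q hq => (h.range q hq).1, he, h.s1_pos, he ▸ h.s1_le, h.adjacent, h.length,
      h.sorted, le_rfl, ?_⟩
    have := h.comparisons
    rw [he, hrest, if_pos rfl] at this
    simp at this
    omega
  · rintro ρ hI ⟨Q, hQ, hpop⟩ hc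
    cases Q with
    | nil =>
      have := List.length_eq_zero_iff.1 hpop.length
      simp [Test.eval, this] at hc
    | cons q Q =>
      exact wp_mergeTop_popping hI hpop (hQ q (by simp)) (by omega)
        fun τ _ _ _ hX h => ⟨⟨Q, fun r hr => hQ r (by simp [hr]), h⟩, hX⟩
  · rintro ρ hI ⟨Q, hQ, hpop⟩ hc
    have hX : ρ.X = [] := by simpa [Test.eval] using hc
    refine Wp.block_nil hI ⟨le_trans ?_ hcostM, ?_⟩
    · have := hpop.cost
      exact_mod_cast (by omega : ρ.mergeCost ≤ M)
    · have := hpop.comparisons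
      simp [hX] at this
      exact this

end MainLoop

/-! ### Space -/

section Space

variable {α : Type*}

/-- A halted configuration is a fixed point of `step`, so the predicate persists for all later
times. -/
theorem Wp.forall_iterate [LinearOrder α] {I Q : Mem α → Prop} {s : Stmt} {σ : Mem α} (h : Wp I s Q σ) :
    (∃ T τ, step^[T] ([s], σ) = ([], τ) ∧ Q τ) ∧ ∀ t, I (step^[t] ([s], σ)).2 := by
  obtain ⟨T, τ, h1, h2, h3⟩ := h []
  refine ⟨⟨T, τ, h1, h2⟩, fun t => ?_⟩
  rcases le_total t T with ht | ht
  · exact h3 t ht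
  · obtain ⟨u, rfl⟩ := Nat.exists_eq_add_of_le' ht
    have hfix : step^[u] (([], τ) : Config α) = ([], τ) := Function.iterate_fixed rfl u
    rw [Function.iterate_add_apply, h1, hfix]
    simpa [h1] using h3 T le_rfl

theorem Safe.space_le {H W : ℕ} {σ : Mem α} (h : Safe H W σ) : σ.space ≤ 16 + 3 * H := by
  have h1 : (σ.X.flatMap fun q => [q.1, q.2]).length = 2 * σ.X.length := by
    induction σ.X with
    | nil => rfl
    | cons q X ih => simp at ih ⊢; omega
  have := h.X_length
  have := h.P_length
  simp only [Mem.space, Mem.words, List.length_append, h1, List.length_map]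
  simp [Reg.all]
  omega

theorem Safe.le_of_mem_words {H W : ℕ} {σ : Mem α} (h : Safe H W σ) {w : ℕ} (hw : w ∈ σ.words) :
    w ≤ W := by
  simp only [Mem.words, List.mem_append, List.mem_map, List.mem_flatMap] at hw
  rcases hw with (⟨x, -, rfl⟩ | ⟨q, hq, hw⟩) | hw
  · exact h.reg x
  · simp at hw
    rcases hw with rfl | rfl
    exacts [(h.X q hq).1, (h.X q hq).2]
  · exact h.P w hw

theorem one_le_logb_two {n : ℕ} (hn : 2 ≤ n) : (1 : ℝ) ≤ Real.logb 2 n := by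
  rw [Real.le_logb_iff_rpow_le (by norm_num) (by positivity)]
  simpa using hn

theorem natLog_le_logb {n : ℕ} (hn : 0 < n) : (Nat.log 2 n : ℝ) ≤ Real.logb 2 n := by
  rw [Real.le_logb_iff_rpow_le (by norm_num) (by positivity), Real.rpow_natCast]
  exact_mod_cast Nat.pow_log_le_self 2 hn.ne'

theorem size_le_of_le {n w : ℕ} (h : w ≤ 4 * n * n) : Nat.size w ≤ 2 * Nat.log 2 n + 4 := by
  rw [Nat.size_le]
  have h1 := Nat.lt_pow_succ_log_self (b := 2) (by norm_num) n
  have h2 : n * n < 2 ^ (Nat.log 2 n).succ * 2 ^ (Nat.log 2 n).succ :=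
    Nat.mul_lt_mul'' h1 h1
  have h3 : 2 ^ (2 * Nat.log 2 n + 4) =
      4 * (2 ^ (Nat.log 2 n).succ * 2 ^ (Nat.log 2 n).succ) := by
    rw [Nat.succ_eq_add_one]; ring
  rw [h3]
  nlinarith

end Space

end PowerSort

theorem theorem3 :
    ∃ C : ℝ, ∀ (α : Type*) [LinearOrder α] (n : ℕ) (A B : ℕ → α), 1 ≤ n →
      -- PowerSort halts, and its merge cost and number of key comparisons are bounded
      (∃ (T : ℕ) (σ : PowerSort.Mem α),
        PowerSort.step^[T] (PowerSort.start A B n) = ([], σ) ∧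
        (σ.mergeCost : ℝ) ≤
          PowerSort.entropy ((PowerSort.runLengths A n).map fun L : ℕ => (L : ℝ) / n) * n + 2 * n ∧
        (σ.comparisons : ℝ) ≤
          PowerSort.entropy ((PowerSort.runLengths A n).map fun L : ℕ => (L : ℝ) / n) * n + 3 * n
            - (PowerSort.runLengths A n).length) ∧
      -- at every time the two stacks have height at most `⌊lg n⌋ + 1`
      (∀ t : ℕ,
        (PowerSort.step^[t] (PowerSort.start A B n)).2.X.length ≤ Nat.log 2 n + 1 ∧
        (PowerSort.step^[t] (PowerSort.start A B n)).2.P.length ≤ Nat.log 2 n + 1) ∧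
      -- at every time `O(log n)` words, of `O(log n)` bits each, are in use
      (2 ≤ n → ∀ t : ℕ,
        ((PowerSort.step^[t] (PowerSort.start A B n)).2.space : ℝ) ≤ C * Real.logb 2 n ∧
        ∀ w ∈ (PowerSort.step^[t] (PowerSort.start A B n)).2.words,
          (Nat.size w : ℝ) ≤ C * Real.logb 2 n) := by
  -- From `16 + 3 * (lg n + 1) ≤ 22 * lg n` for `lg n ≥ 1`; word sizes need only `2 * lg n + 4 ≤ 6 *
  -- lg n`.
  refine ⟨22, fun α _ n A B hn => ?_⟩
  obtain ⟨⟨T, σ, hT, hcost, hcmp⟩, hsafe⟩ :=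
    (PowerSort.wp_powerSort (A := A) (B := B) hn le_rfl).forall_iterate
  rw [PowerSort.costBound_eq hn, PowerSort.runLengths, PowerSort.sum_runLengthsFrom] at hcost
  rw [Nat.add_sub_cancel] at hcost
  refine ⟨⟨T, σ, hT, hcost, ?_⟩, fun t => ⟨(hsafe t).X_length, (hsafe t).P_length⟩,
    fun hn2 t => ?_⟩
  · have h : (σ.comparisons : ℝ) + (PowerSort.runLengths A n).length ≤ σ.mergeCost + n := by
      exact_mod_cast hcmp
    rw [PowerSort.runLengths] at h ⊢
    linarith
  · have h1 := PowerSort.one_le_logb_two hn2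
    have h2 := PowerSort.natLog_le_logb hn
    refine ⟨?_, fun w hw => ?_⟩
    · have h3 : ((PowerSort.step^[t] (PowerSort.start A B n)).2.space : ℝ) ≤
          16 + 3 * ((Nat.log 2 n : ℝ) + 1) := by
        exact_mod_cast (hsafe t).space_le
      linarith
    · have h3 : (Nat.size w : ℝ) ≤ 2 * (Nat.log 2 n : ℝ) + 4 := by
        exact_mod_cast PowerSort.size_le_of_le ((hsafe t).le_of_mem_words hw)
      linarith
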